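/- Let $d\ge 1$. For observations $x_1,x_2,\dots\in\mathbb R^d$ put $s_n=\sum_{i\le n}x_ix_i^\top$ and let $$L_n(\mathcal H)=\frac{|\mathcal H|^{n/2}}{\pi^{nd/2}}\exp\{-\mathrm{tr}(\mathcal H s_n)\}$$ be the likelihood of the half-precision $\mathcal H=\frac12\Sigma^{-1}$ of a zero-mean Gaussian. Consider three models for $\mathcal H$, with mutually unrelated hyperparameters. - Model $A$: $\mathcal H$ is an arbitrary positive definite matrix, with Wishart prior density $\frac{|B|^{\alpha_A}}{\Gamma_d(\alpha_A)}|\mathcal H|^{\alpha_A-\frac{d+1}{2}}e^{-\mathrm{tr}(B\mathcal H)}$ with respect to Lebesgue measure on the entries on and above the diagonal, where $\alpha_A>\frac{d+1}2$, $B$ is positive definite and $\Gamma_d(\alpha)=\pi^{d(d-1)/4}\prod_{j=1}^d\Gamma(\alpha+\frac{1-j}2)$. - Model $D$: $\mathcal H=\mathrm{diag}(\eta_1,\dots,\eta_d)$ with $\eta_j>0$, with independent priors $\eta_j\sim\mathrm{Gamma}(\alpha_D,\beta_j)$ (shape, rate), where $\alpha_D>1$ and $\beta_j>0$. - Model $C$: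 $\mathcal H=\eta I_d$ with $\eta>0$, with prior $\eta\sim\mathrm{Gamma}(\alpha_C,\beta_C)$, where $\alpha_C>1$ and $\beta_C>0$. Let $E_A^{(n)},E_D^{(n)},E_C^{(n)}$ be the evidences, i.e. the integrals of $L_n$ times the prior density over the parameter space of the model, evaluated at the first $n$ of the observations $X_1,X_2,\dots$. In what follows $\overset{p}{\to}$ is convergence in probability as $n\to\infty$. 1. If the $X_i$ are i.i.d. zero-mean Gaussian with half-precision $\eta I_d$, $\eta>0$ ($C$ is true), then $$\frac{1}{\log n}\log\frac{E_A^{(n)}}{E_C^{(n)}}\overset{p}{\to}-\frac{\frac{d(d+1)}2-1}{2},\qquad \frac{1}{\log n}\log\frac{E_D^{(n)}}{E_C^{(n)}}\overset{p}{\to}-\frac{d-1}{2}.$$ 2. If the $X_i$ are i.i.d. zero-mean Gaussian with half-precision $\mathrm{diag}(\eta_1,\dots,\eta_d)$, all $\eta_j>0$ ($D$ is true), then $$\frac{1}{\log n}\log\frac{E_A^{(n)}}{E_D^{(n)}}\overset{p}{\to}-\frac{\frac{d(d+1)}2-d}{2};$$ moreover $\mathbb E[X_iX_i^\top]=\mathrm{diag}(v_1,\dots,v_d)$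 with $v_j=\frac1{2\eta_j}$, and $$\frac1n\log\frac{E_D^{(n)}}{E_C^{(n)}}\overset{p}{\to}\frac d2\log\frac{\frac1d\sum_{j}v_j}{(\prod_{j}v_j)^{1/d}},$$ where the limit is positive unless all the $\eta_j$ are equal. 3. If the $X_i$ are i.i.d. zero-mean Gaussian with positive definite half-precision $\mathcal H_0$ ($A$ is true), then $\mathcal V:=\mathbb E[X_iX_i^\top]=\frac12\mathcal H_0^{-1}$ and $$\frac1n\log\frac{E_A^{(n)}}{E_D^{(n)}}\overset{p}{\to}\frac12\log\frac{\prod_{j}\mathcal V_{jj}}{|\mathcal V|},\qquad \frac1n\log\frac{E_A^{(n)}}{E_C^{(n)}}\overset{p}{\to}\frac d2\log\frac{\mathrm{tr}(\mathcal V)/d}{|\mathcal V|^{1/d}};$$ the first limit is positive unless $\mathcal H_0$ is diagonal, the second unless $\mathcal H_0$ is a multiple of $I_d$. 4. The linear limit in 2 also holds if the $X_i$ are independent draws from the marginal law of one observation under model $D$ (the law with density $x\mapsto E_D^{(1)}(x)$), now with $\mathbb E[X_iX_i^\top]=\mathrm{diag}(v_1,\dots,v_d)$, $v_j=\frac{\beta_j}{2\alpha_D-2}$;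 it is positive unless all the $\beta_j$ are equal. Likewise both limits in 3 hold if the $X_i$ are independent draws from the marginal law of one observation under model $A$ (density $x\mapsto E_A^{(1)}(x)$), now with $\mathcal V=\mathbb E[X_iX_i^\top]=\frac{1}{2\alpha_A-(d+1)}B$; the first is positive unless $B$ is diagonal, the second unless $B$ is a multiple of $I_d$. -/

import Mathlib

open MeasureTheory ProbabilityTheory Filter
open scoped Matrix

noncomputable section

namespace CovSelection

/-- The scatter matrix `s_n = ∑_{i < n} x_i x_iᵀ` of the first `n` observations. -/
def scatter {d : ℕ} (n : ℕ) (x : ℕ → EuclideanSpace ℝ (Fin d)) : Matrix (Fin d) (Fin d) ℝ :=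
  Matrix.of fun j k => ∑ i ∈ Finset.range n, x i j * x i k

/-- The likelihood of the half-precision `H = (2Σ)⁻¹` given `n` observations from a zero-mean
Gaussian: `|H|^{n/2} π^{-nd/2} exp(-tr(H s_n))`. -/
def likelihood {d : ℕ} (H : Matrix (Fin d) (Fin d) ℝ) (n : ℕ)
    (x : ℕ → EuclideanSpace ℝ (Fin d)) : ℝ :=
  H.det ^ ((n : ℝ) / 2) / Real.pi ^ ((n : ℝ) * d / 2) *
    Real.exp (-(H * scatter n x).trace)

/-- The multivariate gamma function
`Γ_d(α) = π^{d(d-1)/4} ∏_{j=1}^d Γ(α + (1-j)/2)`; here `j` runs from `0` to `d-1`. -/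
def multivariateGamma (d : ℕ) (α : ℝ) : ℝ :=
  Real.pi ^ ((d : ℝ) * ((d : ℝ) - 1) / 4) * ∏ j : Fin d, Real.Gamma (α - (j : ℝ) / 2)

/-- The density at a positive definite `H` of the Wishart distribution with shape `α` and rate
matrix `B`, with respect to Lebesgue measure on the entries on and above the diagonal. -/
def wishartDensity {d : ℕ} (α : ℝ) (B H : Matrix (Fin d) (Fin d) ℝ) : ℝ :=
  B.det ^ α / multivariateGamma d α * H.det ^ (α - ((d : ℝ) + 1) / 2) *
    Real.exp (-(B * H).trace)

/-- The symmetric matrix with entries `θ s(i, j)`. The unordered pairs `s(i, j)` label the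
`d(d+1)/2` positions on and above the diagonal, so `θ ↦ symMatrix θ` is the identification of
`ℝ^{d(d+1)/2}` with the symmetric `d × d` matrices. -/
def symMatrix {d : ℕ} (θ : Sym2 (Fin d) → ℝ) : Matrix (Fin d) (Fin d) ℝ :=
  Matrix.of fun i j => θ s(i, j)

/-- Evidence of model `A` (arbitrary positive definite half-precision, Wishart prior). -/
def evidenceA {d : ℕ} (α : ℝ) (B : Matrix (Fin d) (Fin d) ℝ) (n : ℕ)
    (x : ℕ → EuclideanSpace ℝ (Fin d)) : ℝ :=
  ∫ θ in {θ : Sym2 (Fin d) → ℝ | (symMatrix θ).PosDef},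
    likelihood (symMatrix θ) n x * wishartDensity α B (symMatrix θ)

/-- Evidence of model `D` (diagonal half-precision, independent gamma priors with common shape
`α` and rates `β j`). -/
def evidenceD {d : ℕ} (α : ℝ) (β : Fin d → ℝ) (n : ℕ)
    (x : ℕ → EuclideanSpace ℝ (Fin d)) : ℝ :=
  ∫ η in {η : Fin d → ℝ | ∀ j, 0 < η j},
    likelihood (Matrix.diagonal η) n x * ∏ j, gammaPDFReal α (β j) (η j)

/-- Evidence of model `C` (half-precision a positive multiple of the identity, gamma prior with
shape `α` and rate `β`). -/
def evidenceC {d : ℕ} (α β : ℝ) (n : ℕ) (x : ℕ → EuclideanSpace ℝ (Fin d)) : ℝ :=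
  ∫ η in Set.Ioi (0 : ℝ),
    likelihood (η • (1 : Matrix (Fin d) (Fin d) ℝ)) n x * gammaPDFReal α β η

/-- The zero-mean Gaussian law with half-precision `H`, i.e. with covariance matrix `(2H)⁻¹`. -/
def gaussianLaw {d : ℕ} (H : Matrix (Fin d) (Fin d) ℝ) : Measure (EuclideanSpace ℝ (Fin d)) :=
  multivariateGaussian 0 ((2 : ℝ) • H)⁻¹

/-- The marginal law of one observation under model `A`: its density is the Gaussian density
integrated against the Wishart prior, i.e. the evidence of that one observation. -/
def marginalLawA {d : ℕ} (α : ℝ) (B : Matrix (Fin d) (Fin d) ℝ) :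
    Measure (EuclideanSpace ℝ (Fin d)) :=
  volume.withDensity fun x => ENNReal.ofReal (evidenceA α B 1 fun _ => x)

/-- The marginal law of one observation under model `D`. -/
def marginalLawD {d : ℕ} (α : ℝ) (β : Fin d → ℝ) : Measure (EuclideanSpace ℝ (Fin d)) :=
  volume.withDensity fun x => ENNReal.ofReal (evidenceD α β 1 fun _ => x)

/-- `X 0, X 1, …` are independent with common law `ν`. -/
structure IsIID {d : ℕ} {Ω : Type*} [MeasurableSpace Ω] (P : Measure Ω)
    (X : ℕ → Ω → EuclideanSpace ℝ (Fin d)) (ν : Measure (EuclideanSpace ℝ (Fin d))) : Prop where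
  indep : iIndepFun X P
  law : ∀ i, HasLaw (X i) ν P

/-- The random vector `Y` is square integrable and `V = E[Y Yᵀ]`. -/
def HasSecondMoment {d : ℕ} {Ω : Type*} [MeasurableSpace Ω] (P : Measure Ω)
    (Y : Ω → EuclideanSpace ℝ (Fin d)) (V : Matrix (Fin d) (Fin d) ℝ) : Prop :=
  MemLp Y 2 P ∧ ∀ j k, ∫ ω, Y ω j * Y ω k ∂P = V j k

/-- One half of the logarithm of the Hadamard ratio `∏ V_jj / |V|`. -/
def halfLogHadamard {d : ℕ} (V : Matrix (Fin d) (Fin d) ℝ) : ℝ :=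
  1 / 2 * Real.log ((∏ j, V j j) / V.det)

/-- `d/2` times the logarithm of `(tr V / d) / |V|^{1/d}`, the ratio of the arithmetic to the
geometric mean of the eigenvalues of `V`. -/
def logMeanRatio {d : ℕ} (V : Matrix (Fin d) (Fin d) ℝ) : ℝ :=
  (d : ℝ) / 2 * Real.log ((V.trace / d) / V.det ^ (1 / (d : ℝ)))

end CovSelection

end

/-!
The multivariate Gamma integral evaluates all three evidences in closed form. With
`S = sₙ / n`, Stirling's formula turns each of them into a Laplace expansion
`log E = -(n / 2) (crit S + const) - (p / 2) log n + O(1)`, where `p` is the number of free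
parameters of the model, the constant is the same for all three models, and `crit S` is `log |S|`
for model `A`, `∑ log S_jj` for model `D` and `d log (tr S / d)` for model `C`.

By the law of large numbers `S → V = E[XXᵀ]`, so the linear growth rates are half the differences
of the criteria at `V`; these are positive by Hadamard's inequality and the inequality between
arithmetic and geometric means. When the smaller model is true, the criteria of the two models
differ only to second order around `V`. As `S - V = O_P(n^{-1/2})`, this contributes `O_P(1)`, and
the difference of the penalties `(p / 2) log n` remains.

A draw from a marginal law is a scale mixture of Gaussians. Model `D` factors over the coordinates,
and after a linear change of variables the one-observation evidence of model `A` becomes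
the one-observation evidence of model `C`, so that every second moment is that of a Gamma mixture.
-/

noncomputable section

namespace CovSelection

open Asymptotics Topology

/-! ### Log-determinants of positive definite matrices -/

section LogDet

variable {ι : Type*} {M V : Matrix ι ι ℝ}

theorem eventually_posDef_of_isHermitian [Finite ι] (hM : M.PosDef) :
    ∀ᶠ N in 𝓝 M, N.IsHermitian → N.PosDef := by
  have := Fintype.ofFinite ι
  have hcont : Continuous fun p : Matrix ι ι ℝ × (ι → ℝ) => star p.2 ⬝ᵥ p.1 *ᵥ p.2 :=
    Continuous.dotProduct (by fun_prop) (continuous_fst.matrix_mulVec continuous_snd)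
  have hsphere : ∀ᶠ N in 𝓝 M, ∀ x ∈ Metric.sphere (0 : ι → ℝ) 1, 0 < star x ⬝ᵥ N *ᵥ x :=
    (isCompact_sphere _ _).eventually_forall_of_forall_eventually fun x hx =>
      hcont.continuousAt.eventually_const_lt
        (hM.dotProduct_mulVec_pos (ne_zero_of_mem_unit_sphere ⟨x, hx⟩))
  filter_upwards [hsphere] with N hN hherm
  refine .of_dotProduct_mulVec_pos hherm fun x hx => ?_
  have hpos : 0 < ‖x‖⁻¹ := inv_pos.2 (norm_pos_iff.2 hx)
  have h := hN (‖x‖⁻¹ • x) (by simp [norm_smul, hx])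
  rw [star_smul, Matrix.mulVec_smul, smul_dotProduct, dotProduct_smul, star_trivial ‖x‖⁻¹] at h
  exact pos_of_mul_pos_right (pos_of_mul_pos_right h hpos.le) hpos.le

theorem sqrt_diag_pos (hV : V.PosDef) (j : ι) : 0 < √(V j j) :=
  Real.sqrt_pos.2 hV.diag_pos

theorem trace_div_card_pos [Fintype ι] [Nonempty ι] (hV : V.PosDef) :
    0 < V.trace / Fintype.card ι :=
  div_pos hV.trace_pos (mod_cast Fintype.card_pos)

variable [Fintype ι] [DecidableEq ι]

theorem log_det_eq_sum_log_eigenvalues (hM : M.PosDef) :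
    Real.log M.det = ∑ i, Real.log (hM.isHermitian.eigenvalues i) := by
  rw [hM.isHermitian.det_eq_prod_eigenvalues]
  exact Real.log_prod fun i _ => (hM.eigenvalues_pos i).ne'

theorem exists_eigenvalue_ne_one (hM : M.IsHermitian) (h1 : M ≠ 1) :
    ∃ i, hM.eigenvalues i ≠ 1 := by
  contrapose! h1
  have hdiag : (RCLike.ofReal ∘ hM.eigenvalues : ι → ℝ) = 1 := by
    ext i
    simp [h1 i]
  rw [hM.spectral_theorem, hdiag]
  simp

theorem log_det_lt_trace_sub_card (hM : M.PosDef) (h1 : M ≠ 1) :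
    Real.log M.det < M.trace - Fintype.card ι := by
  obtain ⟨i, hi⟩ := exists_eigenvalue_ne_one hM.isHermitian h1
  have h : ∑ i, Real.log (hM.isHermitian.eigenvalues i) <
      ∑ i, (hM.isHermitian.eigenvalues i - 1) :=
    Finset.sum_lt_sum (fun j _ => Real.log_le_sub_one_of_pos (hM.eigenvalues_pos j))
      ⟨i, Finset.mem_univ i, Real.log_lt_sub_one_of_pos (hM.eigenvalues_pos i) hi⟩
  rw [log_det_eq_sum_log_eigenvalues hM, hM.isHermitian.trace_eq_sum_eigenvalues]
  simpa using h

theorem log_det_le_trace_sub_card (hM : M.PosDef) :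
    Real.log M.det ≤ M.trace - Fintype.card ι := by
  rcases eq_or_ne M 1 with rfl | h1
  · simp
  · exact (log_det_lt_trace_sub_card hM h1).le

/-- The matrix `V i j / √(V i i * V j j)`. For positive definite `V` its trace is the dimension,
so that comparing its log-determinant with its trace gives Hadamard's inequality for `V`. -/
def correlation (V : Matrix ι ι ℝ) : Matrix ι ι ℝ :=
  Matrix.diagonal (fun j => (√(V j j))⁻¹) * V * Matrix.diagonal (fun j => (√(V j j))⁻¹)

theorem correlation_apply (V : Matrix ι ι ℝ) (i j : ι) :
    correlation V i j = (√(V i i))⁻¹ * V i j * (√(V j j))⁻¹ := by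
  simp [correlation]

theorem posDef_correlation (hV : V.PosDef) : (correlation V).PosDef := by
  have hunit : IsUnit (Matrix.diagonal fun j => (√(V j j))⁻¹) := by
    rw [Matrix.isUnit_diagonal, Pi.isUnit_iff]
    exact fun j => (inv_ne_zero (sqrt_diag_pos hV j).ne').isUnit
  have h := (Matrix.IsUnit.posDef_star_left_conjugate_iff (x := V) hunit).2 hV
  simpa [correlation, Matrix.star_eq_conjTranspose, Matrix.diagonal_conjTranspose] using h

theorem trace_correlation (hV : V.PosDef) : (correlation V).trace = Fintype.card ι := by
  have hdiag (j : ι) : correlation V j j = 1 := by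
    have := sqrt_diag_pos hV j
    rw [correlation_apply]
    field_simp
    rw [Real.sq_sqrt hV.diag_pos.le]
  simp [Matrix.trace, hdiag]

theorem log_det_correlation (hV : V.PosDef) :
    Real.log (correlation V).det = Real.log V.det - ∑ j, Real.log (V j j) := by
  have hne (j : ι) : (√(V j j))⁻¹ ≠ 0 := inv_ne_zero (sqrt_diag_pos hV j).ne'
  have hprod : ∏ j, (√(V j j))⁻¹ ≠ 0 := Finset.prod_ne_zero_iff.2 fun j _ => hne j
  rw [correlation, Matrix.det_mul, Matrix.det_mul, Matrix.det_diagonal,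
    Real.log_mul (mul_ne_zero hprod hV.det_pos.ne') hprod, Real.log_mul hprod hV.det_pos.ne',
    Real.log_prod fun j _ => hne j]
  simp only [Real.log_inv, Real.log_sqrt hV.diag_pos.le, Finset.sum_neg_distrib,
    ← Finset.sum_div]
  ring

theorem isDiag_of_correlation_eq_one (hV : V.PosDef) (h : correlation V = 1) : V.IsDiag := by
  intro i j hij
  have hzero := congrFun₂ h i j
  rw [correlation_apply, Matrix.one_apply_ne hij] at hzero
  simpa [(sqrt_diag_pos hV _).ne'] using hzero

theorem log_det_lt_sum_log_diag (hV : V.PosDef) (hdiag : ¬ V.IsDiag) :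
    Real.log V.det < ∑ j, Real.log (V j j) := by
  have h := log_det_lt_trace_sub_card (posDef_correlation hV)
    (mt (isDiag_of_correlation_eq_one hV) hdiag)
  rw [trace_correlation hV, log_det_correlation hV] at h
  linarith

theorem log_det_le_sum_log_diag (hV : V.PosDef) :
    Real.log V.det ≤ ∑ j, Real.log (V j j) := by
  have h := log_det_le_trace_sub_card (posDef_correlation hV)
  rw [trace_correlation hV, log_det_correlation hV] at h
  linarith

theorem log_det_smul (hV : V.PosDef) {c : ℝ} (hc : 0 < c) :
    Real.log (c • V).det = Fintype.card ι * Real.log c + Real.log V.det := by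
  rw [Matrix.det_smul, Real.log_mul (by positivity) hV.det_pos.ne', Real.log_pow]

variable [Nonempty ι]

theorem log_det_lt_card_mul_log_mean (hV : V.PosDef)
    (hscalar : ¬ ∃ c : ℝ, V = c • (1 : Matrix ι ι ℝ)) :
    Real.log V.det < Fintype.card ι * Real.log (V.trace / Fintype.card ι) := by
  have hmean := trace_div_card_pos hV
  have hne : (V.trace / Fintype.card ι)⁻¹ • V ≠ 1 := fun h =>
    hscalar ⟨_, (inv_smul_eq_iff₀ hmean.ne').1 h⟩
  have h := log_det_lt_trace_sub_card (hV.smul (inv_pos.2 hmean)) hne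
  rw [log_det_smul hV (inv_pos.2 hmean), Matrix.trace_smul, Real.log_inv, inv_div, smul_eq_mul,
    div_mul_cancel₀ _ hV.trace_pos.ne'] at h
  linarith

theorem log_det_le_card_mul_log_mean (hV : V.PosDef) :
    Real.log V.det ≤ Fintype.card ι * Real.log (V.trace / Fintype.card ι) := by
  by_cases hscalar : ∃ c : ℝ, V = c • (1 : Matrix ι ι ℝ)
  · obtain ⟨c, rfl⟩ := hscalar
    simp
  · exact (log_det_lt_card_mul_log_mean hV hscalar).le

end LogDet

section LimitConstants

variable {d : ℕ} {V : Matrix (Fin d) (Fin d) ℝ}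

theorem halfLogHadamard_eq (hV : V.PosDef) :
    halfLogHadamard V = 1 / 2 * (∑ j, Real.log (V j j) - Real.log V.det) := by
  have hne (j : Fin d) : V j j ≠ 0 := hV.diag_pos.ne'
  rw [halfLogHadamard, Real.log_div (Finset.prod_ne_zero_iff.2 fun j _ => hne j) hV.det_pos.ne',
    Real.log_prod fun j _ => hne j]

theorem halfLogHadamard_pos (hV : V.PosDef) (hdiag : ¬ V.IsDiag) : 0 < halfLogHadamard V := by
  have := log_det_lt_sum_log_diag hV hdiag
  rw [halfLogHadamard_eq hV]
  linarith

theorem logMeanRatio_eq [NeZero d] (hV : V.PosDef) :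
    logMeanRatio V = 1 / 2 * (d * Real.log (V.trace / d) - Real.log V.det) := by
  have hmean : 0 < V.trace / d := by simpa using trace_div_card_pos hV
  have hd : (d : ℝ) ≠ 0 := NeZero.ne _
  have hdet := hV.det_pos
  rw [logMeanRatio, Real.log_div hmean.ne' (by positivity), Real.log_rpow hdet]
  field_simp

theorem logMeanRatio_pos [NeZero d] (hV : V.PosDef)
    (hscalar : ¬ ∃ c : ℝ, V = c • (1 : Matrix (Fin d) (Fin d) ℝ)) : 0 < logMeanRatio V := by
  have := log_det_lt_card_mul_log_mean hV hscalar
  rw [Fintype.card_fin] at this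
  rw [logMeanRatio_eq hV]
  linarith

theorem logMeanRatio_diagonal (v : Fin d → ℝ) : logMeanRatio (Matrix.diagonal v) =
    (d : ℝ) / 2 * Real.log (((∑ j, v j) / d) / (∏ j, v j) ^ (1 / (d : ℝ))) := by
  rw [logMeanRatio, Matrix.trace_diagonal, Matrix.det_diagonal]

theorem logMeanRatio_diagonal_pos [NeZero d] {v : Fin d → ℝ} (hv : ∀ j, 0 < v j)
    (hconst : ¬ ∃ c, ∀ j, v j = c) : 0 < logMeanRatio (Matrix.diagonal v) := by
  refine logMeanRatio_pos (Matrix.PosDef.diagonal hv) fun ⟨c, hc⟩ => hconst ⟨c, fun j => ?_⟩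
  simpa using congrFun₂ hc j j

end LimitConstants

section SymMatrix

variable {d : ℕ} {θ : Sym2 (Fin d) → ℝ}

theorem symMatrix_apply (θ : Sym2 (Fin d) → ℝ) (i j : Fin d) : symMatrix θ i j = θ s(i, j) := rfl

theorem symMatrix_add (θ η : Sym2 (Fin d) → ℝ) :
    symMatrix (θ + η) = symMatrix θ + symMatrix η := rfl

theorem symMatrix_smul (c : ℝ) (θ : Sym2 (Fin d) → ℝ) : symMatrix (c • θ) = c • symMatrix θ := rfl

theorem trace_symMatrix (θ : Sym2 (Fin d) → ℝ) : (symMatrix θ).trace = ∑ j, θ s(j, j) := rfl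

theorem isHermitian_symMatrix (θ : Sym2 (Fin d) → ℝ) : (symMatrix θ).IsHermitian := by
  ext i j
  simp [symMatrix, Sym2.eq_swap]

theorem exists_symMatrix_eq {V : Matrix (Fin d) (Fin d) ℝ} (hV : V.IsHermitian) :
    ∃ θ : Sym2 (Fin d) → ℝ, symMatrix θ = V :=
  ⟨Sym2.lift ⟨V, fun i j => by simpa using (hV.apply i j).symm⟩, rfl⟩

theorem continuous_symMatrix :
    Continuous (symMatrix : (Sym2 (Fin d) → ℝ) → Matrix (Fin d) (Fin d) ℝ) :=
  continuous_matrix fun _ _ => continuous_apply _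

theorem isOpen_setOf_posDef_symMatrix : IsOpen {θ : Sym2 (Fin d) → ℝ | (symMatrix θ).PosDef} := by
  rw [isOpen_iff_eventually]
  intro θ hθ
  filter_upwards [continuous_symMatrix.continuousAt.eventually
    (eventually_posDef_of_isHermitian hθ)] with η hη
  exact hη (isHermitian_symMatrix η)

end SymMatrix

/-! ### Gamma and Gaussian integrals -/

section Integrals

theorem lintegral_ofReal_of_integral_eq {α : Type*} [MeasurableSpace α] {μ : Measure α}
    {f : α → ℝ} {c : ℝ} (hf : 0 ≤ᵐ[μ] f) (hint : ∫ x, f x ∂μ = c) (hc : c ≠ 0) :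
    ∫⁻ x, ENNReal.ofReal (f x) ∂μ = ENNReal.ofReal c := by
  rw [← hint, ofReal_integral_eq_lintegral_ofReal (.of_integral_ne_zero (hint ▸ hc)) hf]

theorem integral_Ioi_rpow_mul_exp_neg {a b : ℝ} (ha : 0 < a) (hb : 0 < b) :
    ∫ s in Set.Ioi (0 : ℝ), s ^ (a - 1) * Real.exp (-(b * s)) = Real.Gamma a * b ^ (-a) := by
  rw [Real.integral_rpow_mul_exp_neg_mul_Ioi ha hb, one_div, Real.inv_rpow hb.le,
    Real.rpow_neg hb.le, mul_comm]

theorem Gamma_mul_rpow_pos {a b : ℝ} (ha : 0 < a) (hb : 0 < b) : 0 < Real.Gamma a * b ^ (-a) :=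
  mul_pos (Real.Gamma_pos_of_pos ha) (Real.rpow_pos_of_pos hb _)

theorem lintegral_Ioi_rpow_mul_exp_neg {a b : ℝ} (ha : 0 < a) (hb : 0 < b) :
    ∫⁻ s in Set.Ioi (0 : ℝ), ENNReal.ofReal (s ^ (a - 1) * Real.exp (-(b * s))) =
      ENNReal.ofReal (Real.Gamma a * b ^ (-a)) := by
  refine lintegral_ofReal_of_integral_eq (ae_restrict_of_forall_mem measurableSet_Ioi ?_)
    (integral_Ioi_rpow_mul_exp_neg ha hb) (Gamma_mul_rpow_pos ha hb).ne'
  exact fun s (hs : 0 < s) => by simp only [Pi.zero_apply]; positivity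

theorem integral_exp_neg_sq_sub_linear {b : ℝ} (hb : b ≠ 0) (c : ℝ) :
    ∫ w : ℝ, Real.exp (-(b * w ^ 2) - 2 * (c * w)) =
      √(Real.pi / b) * Real.exp (c ^ 2 / b) := by
  have hsquare (w : ℝ) : Real.exp (-(b * w ^ 2) - 2 * (c * w)) =
      Real.exp (c ^ 2 / b) * Real.exp (-b * (w + c / b) ^ 2) := by
    rw [← Real.exp_add]
    congr 1
    field_simp
    ring
  simp_rw [hsquare]
  rw [integral_const_mul, integral_add_right_eq_self (fun w => Real.exp (-b * w ^ 2)),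
    integral_gaussian, mul_comm]

variable {ι : Type*} [Fintype ι]

theorem integral_exp_neg_dotProduct_sub_linear {b : ℝ} (hb : 0 < b) (c : ι → ℝ) :
    ∫ w : ι → ℝ, Real.exp (-(b * (w ⬝ᵥ w)) - 2 * (c ⬝ᵥ w)) =
      (Real.pi / b) ^ ((Fintype.card ι : ℝ) / 2) * Real.exp ((c ⬝ᵥ c) / b) := by
  have hprod (w : ι → ℝ) : Real.exp (-(b * (w ⬝ᵥ w)) - 2 * (c ⬝ᵥ w)) =
      ∏ j, Real.exp (-(b * w j ^ 2) - 2 * (c j * w j)) := by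
    rw [← Real.exp_sum]
    simp only [dotProduct, Finset.mul_sum, Finset.sum_sub_distrib, Finset.sum_neg_distrib, sq]
  simp_rw [hprod]
  rw [integral_fintype_prod_volume_eq_prod
    (f := fun j w => Real.exp (-(b * w ^ 2) - 2 * (c j * w)))]
  simp_rw [integral_exp_neg_sq_sub_linear hb.ne']
  rw [Finset.prod_mul_distrib, ← Real.exp_sum, Finset.prod_const, Finset.card_univ,
    Real.sqrt_eq_rpow, ← Real.rpow_natCast, ← Real.rpow_mul (by positivity), one_div_mul_eq_div]
  simp only [dotProduct, Finset.sum_div, sq]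

theorem exists_eq_mul_transpose {K : Matrix ι ι ℝ} (hK : K.PosSemidef) :
    ∃ R : Matrix ι ι ℝ, K = R * Rᵀ := by
  classical
  open scoped MatrixOrder in
  obtain ⟨R, hR⟩ := CStarAlgebra.nonneg_iff_eq_star_mul_self.1 hK.nonneg
  exact ⟨Rᵀ, by simpa [Matrix.star_eq_conjTranspose] using hR⟩

variable [DecidableEq ι] {K : Matrix ι ι ℝ}

theorem integral_comp_mulVec {E : Type*} [NormedAddCommGroup E] [NormedSpace ℝ E]
    {R : Matrix ι ι ℝ} (hR : R.det ≠ 0) (f : (ι → ℝ) → E) :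
    ∫ w, f (R *ᵥ w) = |R.det|⁻¹ • ∫ u, f u := by
  have hemb : MeasurableEmbedding (Matrix.toLin' R) :=
    (Matrix.toLinearEquiv' R (R.invertibleOfIsUnitDet hR.isUnit)).toContinuousLinearEquiv
      |>.toHomeomorph.measurableEmbedding
  have hmap := hemb.integral_map (μ := volume) f
  rw [Real.map_matrix_volume_pi_eq_smul_volume_pi hR, integral_smul_measure, abs_inv,
    ENNReal.toReal_ofReal (by positivity)] at hmap
  exact hmap.symm

theorem mulVec_dotProduct_inv_mul_transpose_mulVec {R : Matrix ι ι ℝ} (hR : IsUnit R.det)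
    (w : ι → ℝ) : R *ᵥ w ⬝ᵥ (R * Rᵀ)⁻¹ *ᵥ R *ᵥ w = w ⬝ᵥ w := by
  have hcancel : Rᵀ * ((R * Rᵀ)⁻¹ * R) = 1 := by
    rw [Matrix.mul_inv_rev, Matrix.mul_assoc, Matrix.nonsing_inv_mul _ hR, Matrix.mul_one,
      Matrix.mul_nonsing_inv _ (by rwa [Matrix.det_transpose])]
  rw [← Matrix.vecMul_transpose R w, ← Matrix.dotProduct_mulVec, Matrix.vecMul_transpose,
    Matrix.mulVec_mulVec, Matrix.mulVec_mulVec, Matrix.mul_assoc, hcancel, Matrix.one_mulVec]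

theorem integral_exp_neg_quadratic_sub_linear (hK : K.PosDef) {b : ℝ} (hb : 0 < b) (c : ι → ℝ) :
    ∫ u : ι → ℝ, Real.exp (-(b * (u ⬝ᵥ K⁻¹ *ᵥ u)) - 2 * (c ⬝ᵥ u)) =
      (Real.pi / b) ^ ((Fintype.card ι : ℝ) / 2) * √K.det * Real.exp ((c ⬝ᵥ K *ᵥ c) / b) := by
  obtain ⟨R, rfl⟩ := exists_eq_mul_transpose hK.posSemidef
  have hdet : (R * Rᵀ).det = R.det ^ 2 := by rw [Matrix.det_mul, Matrix.det_transpose, sq]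
  have hR : R.det ≠ 0 := pow_ne_zero_iff two_ne_zero |>.1 (hdet ▸ hK.det_pos.ne')
  have hc : (Rᵀ *ᵥ c) ⬝ᵥ (Rᵀ *ᵥ c) = c ⬝ᵥ (R * Rᵀ) *ᵥ c := by
    rw [← Matrix.mulVec_mulVec, Matrix.dotProduct_mulVec c, Matrix.mulVec_transpose]
  have hsubst := integral_comp_mulVec hR fun u : ι → ℝ =>
    Real.exp (-(b * (u ⬝ᵥ (R * Rᵀ)⁻¹ *ᵥ u)) - 2 * (c ⬝ᵥ u))
  simp_rw [mulVec_dotProduct_inv_mul_transpose_mulVec hR.isUnit, Matrix.dotProduct_mulVec c,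
    ← Matrix.mulVec_transpose] at hsubst
  rw [integral_exp_neg_dotProduct_sub_linear hb, hc, smul_eq_mul,
    eq_inv_mul_iff_mul_eq₀ (abs_ne_zero.2 hR)] at hsubst
  rw [← hsubst, hdet, Real.sqrt_sq_eq_abs]
  ring

theorem lintegral_exp_neg_quadratic_sub_linear (hK : K.PosDef) {b : ℝ} (hb : 0 < b)
    (c : ι → ℝ) :
    ∫⁻ u : ι → ℝ, ENNReal.ofReal (Real.exp (-(b * (u ⬝ᵥ K⁻¹ *ᵥ u)) - 2 * (c ⬝ᵥ u))) =
      ENNReal.ofReal ((Real.pi / b) ^ ((Fintype.card ι : ℝ) / 2) * √K.det *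
        Real.exp ((c ⬝ᵥ K *ᵥ c) / b)) := by
  have hdet := hK.det_pos
  exact lintegral_ofReal_of_integral_eq (.of_forall fun _ => (Real.exp_pos _).le)
    (integral_exp_neg_quadratic_sub_linear hK hb c) (by positivity)

end Integrals

/-! ### Bordered matrices and Schur complements -/

section Bordered

theorem posDef_submatrix_equiv {m n : Type*} (e : m ≃ n) {M : Matrix n n ℝ} :
    (M.submatrix e e).PosDef ↔ M.PosDef :=
  ⟨fun h => by simpa using h.submatrix e.symm.injective, fun h => h.submatrix e.injective⟩

theorem posDef_fromBlocks₁₁_iff {m n : Type*} [Fintype m] [Finite n] [DecidableEq m]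
    {A : Matrix m m ℝ} (hA : A.PosDef) (B : Matrix m n ℝ) (D : Matrix n n ℝ) :
    (Matrix.fromBlocks A B Bᵀ D).PosDef ↔ (D - Bᵀ * A⁻¹ * B).PosDef := by
  classical
  have := Fintype.ofFinite n
  let := hA.isUnit.invertible
  have hdet : (Matrix.fromBlocks A B Bᵀ D).det = A.det * (D - Bᵀ * A⁻¹ * B).det := by
    rw [Matrix.det_fromBlocks₁₁, Matrix.invOf_eq_nonsing_inv]
  have hpsd : (Matrix.fromBlocks A B Bᵀ D).PosSemidef ↔ (D - Bᵀ * A⁻¹ * B).PosSemidef := by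
    simpa using Matrix.PosDef.fromBlocks₁₁ B D hA
  constructor <;> intro h
  · exact (hpsd.1 h.posSemidef).posDef_iff_det_ne_zero.2
      (right_ne_zero_of_mul (hdet ▸ h.det_pos.ne'))
  · exact (hpsd.2 h.posSemidef).posDef_iff_det_ne_zero.2
      (hdet ▸ (mul_pos hA.det_pos h.det_pos).ne')

variable {d : ℕ}

/-- The square matrix of size `d + 1` with first diagonal entry `h`, remaining first row and
column `u`, and lower right block `K`. -/
def bordered (h : ℝ) (u : Fin d → ℝ) (K : Matrix (Fin d) (Fin d) ℝ) :
    Matrix (Fin (d + 1)) (Fin (d + 1)) ℝ :=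
  Matrix.of (Fin.cons (Fin.cons h u) fun i => Fin.cons (u i) (K i))

variable {h b : ℝ} {u c : Fin d → ℝ} {K B : Matrix (Fin d) (Fin d) ℝ}

theorem exists_bordered_eq {M : Matrix (Fin (d + 1)) (Fin (d + 1)) ℝ} (hM : M.IsHermitian) :
    ∃ h u K, bordered h u K = M := by
  refine ⟨M 0 0, fun j => M 0 j.succ, M.submatrix Fin.succ Fin.succ, ?_⟩
  ext i j
  induction i using Fin.cases <;> induction j using Fin.cases
  · rfl
  · rfl
  · exact (hM.apply _ _).symm
  · rfl

theorem posDef_of_posDef_bordered (hM : (bordered h u K).PosDef) : K.PosDef :=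
  hM.submatrix (Fin.succ_injective d)

theorem pos_of_posDef_bordered (hM : (bordered h u K).PosDef) : 0 < h := hM.diag_pos (i := 0)

/-- `Fin (d + 1)` with its first element split off. -/
def finSuccEquivSum (d : ℕ) : Fin (d + 1) ≃ Unit ⊕ Fin d :=
  (finSuccEquiv d).trans ((Equiv.optionEquivSumPUnit _).trans (Equiv.sumComm _ _))

theorem bordered_eq_submatrix_fromBlocks (h : ℝ) (u : Fin d → ℝ) (K : Matrix (Fin d) (Fin d) ℝ) :
    bordered h u K = (Matrix.fromBlocks (Matrix.diagonal fun _ : Unit => h)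
      (Matrix.replicateRow Unit u) (Matrix.replicateCol Unit u) K).submatrix
        (finSuccEquivSum d) (finSuccEquivSum d) := by
  ext i j
  induction i using Fin.cases <;> induction j using Fin.cases <;>
    simp [bordered, finSuccEquivSum]

theorem replicateRow_mul_mul_replicateCol (u : Fin d → ℝ) (K : Matrix (Fin d) (Fin d) ℝ) :
    Matrix.replicateRow Unit u * K * Matrix.replicateCol Unit u =
      Matrix.diagonal fun _ => u ⬝ᵥ K *ᵥ u := by
  ext
  rw [Matrix.mul_assoc, ← Matrix.replicateCol_mulVec]
  simp

theorem det_bordered (hK : IsUnit K) (h : ℝ) (u : Fin d → ℝ) :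
    (bordered h u K).det = K.det * (h - u ⬝ᵥ K⁻¹ *ᵥ u) := by
  let := hK.invertible
  rw [bordered_eq_submatrix_fromBlocks, Matrix.det_submatrix_equiv_self, Matrix.det_fromBlocks₂₂,
    Matrix.invOf_eq_nonsing_inv, replicateRow_mul_mul_replicateCol, Matrix.diagonal_sub]
  simp

theorem posDef_bordered_iff_of_posDef (hK : K.PosDef) :
    (bordered h u K).PosDef ↔ 0 < h - u ⬝ᵥ K⁻¹ *ᵥ u := by
  have hschur := posDef_fromBlocks₁₁_iff hK (Matrix.replicateCol Unit u)
    (Matrix.diagonal fun _ => h)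
  rw [Matrix.transpose_replicateCol, replicateRow_mul_mul_replicateCol, Matrix.diagonal_sub,
    Matrix.posDef_diagonal_iff, ← posDef_submatrix_equiv (Equiv.sumComm _ _),
    Equiv.sumComm_apply, Matrix.fromBlocks_submatrix_sum_swap_sum_swap] at hschur
  rw [bordered_eq_submatrix_fromBlocks, posDef_submatrix_equiv, hschur, forall_const]

theorem replicateCol_mul_inv_mul_replicateRow (hb : b ≠ 0) (c : Fin d → ℝ) :
    Matrix.replicateCol Unit c * (Matrix.diagonal fun _ : Unit => b)⁻¹ *
      Matrix.replicateRow Unit c = b⁻¹ • Matrix.vecMulVec c c := by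
  have hinv : (Matrix.diagonal fun _ : Unit => b)⁻¹ = Matrix.diagonal fun _ => b⁻¹ :=
    Matrix.inv_eq_right_inv (by simp [hb])
  rw [hinv]
  ext i j
  simp [Matrix.mul_apply, Matrix.vecMulVec_apply]
  ring

theorem det_bordered_eq_mul_det_schur (hb : b ≠ 0) (c : Fin d → ℝ)
    (B : Matrix (Fin d) (Fin d) ℝ) :
    (bordered b c B).det = b * (B - b⁻¹ • Matrix.vecMulVec c c).det := by
  have hdet : (Matrix.diagonal fun _ : Unit => b).det = b := by simp
  let := ((Matrix.isUnit_iff_isUnit_det _).2 (hdet ▸ hb.isUnit)).invertible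
  rw [bordered_eq_submatrix_fromBlocks, Matrix.det_submatrix_equiv_self, Matrix.det_fromBlocks₁₁,
    Matrix.invOf_eq_nonsing_inv, replicateCol_mul_inv_mul_replicateRow hb, hdet]

theorem posDef_schur_of_bordered (hM : (bordered b c B).PosDef) :
    (B - b⁻¹ • Matrix.vecMulVec c c).PosDef := by
  have hb := pos_of_posDef_bordered hM
  have hschur := posDef_fromBlocks₁₁_iff (.diagonal fun _ => hb) (Matrix.replicateRow Unit c) B
  rw [Matrix.transpose_replicateRow, replicateCol_mul_inv_mul_replicateRow hb.ne'] at hschur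
  rw [bordered_eq_submatrix_fromBlocks, posDef_submatrix_equiv] at hM
  exact hschur.1 hM

theorem trace_bordered_mul (b h : ℝ) (c u : Fin d → ℝ) (B K : Matrix (Fin d) (Fin d) ℝ) :
    (bordered b c B * bordered h u K).trace = b * h + 2 * (c ⬝ᵥ u) + (B * K).trace := by
  simp [bordered, Matrix.trace, Matrix.mul_apply, dotProduct, Fin.sum_univ_succ,
    Finset.sum_add_distrib]
  ring

theorem trace_sub_vecMulVec_mul (B K : Matrix (Fin d) (Fin d) ℝ) (b : ℝ) (c : Fin d → ℝ) :
    ((B - b⁻¹ • Matrix.vecMulVec c c) * K).trace = (B * K).trace - (c ⬝ᵥ K *ᵥ c) / b := by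
  rw [Matrix.sub_mul, Matrix.trace_sub, Matrix.smul_mul, Matrix.trace_smul,
    Matrix.vecMulVec_mul, Matrix.trace_vecMulVec, smul_eq_mul, Matrix.dotProduct_mulVec,
    dotProduct_comm, div_eq_inv_mul]

end Bordered

/-! ### The Wishart integral -/

section WishartIntegral

variable {d : ℕ}

/-- Labels of the unordered pairs from `{0, …, d}`: those avoiding `0`, then the pairs
`{0, j + 1}`, then `{0, 0}`. -/
def sym2Block (d : ℕ) : Sym2 (Fin d) ⊕ (Fin d ⊕ Unit) → Sym2 (Fin (d + 1)) :=
  Sum.elim (Sym2.map Fin.succ) (Sum.elim (fun j => s(0, j.succ)) fun _ => s(0, 0))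

theorem sym2Block_injective : Function.Injective (sym2Block d) := by
  have hne (z : Sym2 (Fin d)) (k : Fin (d + 1)) : Sym2.map Fin.succ z ≠ s(0, k) := by
    induction z with
    | h i j => simp [Sym2.map_mk, Fin.succ_ne_zero]
  refine (Sym2.map.injective (Fin.succ_injective d)).sumElim (.sumElim ?_ ?_ ?_) ?_
  · exact fun i j hij => by simpa [Fin.succ_ne_zero] using hij
  · exact Function.injective_of_subsingleton _
  · simp [Fin.succ_ne_zero]
  · rintro z (j | _)
    exacts [hne z _, hne z _]

theorem sym2Block_surjective : Function.Surjective (sym2Block d) := by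
  intro z
  induction z with
  | h i j =>
    induction i using Fin.cases with
    | zero =>
      induction j using Fin.cases with
      | zero => exact ⟨.inr (.inr ()), rfl⟩
      | succ j => exact ⟨.inr (.inl j), rfl⟩
    | succ i =>
      induction j using Fin.cases with
      | zero => exact ⟨.inr (.inl i), Sym2.eq_swap⟩
      | succ j => exact ⟨.inl s(i, j), rfl⟩

/-- The labelling `sym2Block` as an equivalence. -/
def sym2BlockEquiv (d : ℕ) : Sym2 (Fin d) ⊕ (Fin d ⊕ Unit) ≃ Sym2 (Fin (d + 1)) :=
  Equiv.ofBijective _ ⟨sym2Block_injective, sym2Block_surjective⟩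

/-- The coordinates of a symmetric matrix of size `d + 1`, assembled from those of its lower right
block, the rest of its first row, and its first diagonal entry. -/
def assemble (d : ℕ) (p : (Sym2 (Fin d) → ℝ) × (Fin d → ℝ) × ℝ) : Sym2 (Fin (d + 1)) → ℝ :=
  MeasurableEquiv.piCongrLeft (fun _ => ℝ) (sym2BlockEquiv d)
    ((MeasurableEquiv.sumPiEquivProdPi fun _ => ℝ).symm
      (p.1, (MeasurableEquiv.sumPiEquivProdPi fun _ => ℝ).symm (p.2.1,
        (MeasurableEquiv.funUnique Unit ℝ).symm p.2.2)))

theorem measurePreserving_assemble : MeasurePreserving (assemble d) volume volume := by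
  have hrow : MeasurePreserving (fun p : (Fin d → ℝ) × ℝ =>
      (MeasurableEquiv.sumPiEquivProdPi fun _ => ℝ).symm (p.1,
        (MeasurableEquiv.funUnique Unit ℝ).symm p.2)) volume volume :=
    (volume_measurePreserving_sumPiEquivProdPi_symm fun _ : Fin d ⊕ Unit => ℝ).comp
      ((MeasurePreserving.id volume).prod (volume_preserving_funUnique Unit ℝ).symm)
  exact (volume_measurePreserving_piCongrLeft (fun _ => ℝ) (sym2BlockEquiv d)).comp
    ((volume_measurePreserving_sumPiEquivProdPi_symm
      fun _ : Sym2 (Fin d) ⊕ (Fin d ⊕ Unit) => ℝ).comp ((MeasurePreserving.id volume).prod hrow))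

theorem assemble_sym2Block (p : (Sym2 (Fin d) → ℝ) × (Fin d → ℝ) × ℝ)
    (a : Sym2 (Fin d) ⊕ (Fin d ⊕ Unit)) :
    assemble d p (sym2Block d a) = Sum.elim p.1 (Sum.elim p.2.1 fun _ => p.2.2) a := by
  refine (Equiv.piCongrLeft_apply_apply (fun _ => ℝ) (sym2BlockEquiv d) _ a).trans ?_
  rcases a with z | j | u <;> rfl

theorem symMatrix_assemble (K : Sym2 (Fin d) → ℝ) (u : Fin d → ℝ) (h : ℝ) :
    symMatrix (assemble d (K, u, h)) = bordered h u (symMatrix K) := by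
  have hassemble := assemble_sym2Block (K, u, h)
  ext i j
  induction i using Fin.cases <;> induction j using Fin.cases
  · exact hassemble (.inr (.inr ()))
  · exact hassemble (.inr (.inl _))
  · rw [symMatrix_apply, Sym2.eq_swap]
    exact hassemble (.inr (.inl _))
  · exact hassemble (.inl s(_, _))

theorem multivariateGamma_succ (d : ℕ) (α : ℝ) :
    multivariateGamma (d + 1) α =
      Real.pi ^ ((d : ℝ) / 2) * Real.Gamma (α - d / 2) * multivariateGamma d α := by
  have hpi : Real.pi ^ (((d + 1 : ℕ) : ℝ) * (((d + 1 : ℕ) : ℝ) - 1) / 4) =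
      Real.pi ^ ((d : ℝ) / 2) * Real.pi ^ ((d : ℝ) * ((d : ℝ) - 1) / 4) := by
    rw [← Real.rpow_add Real.pi_pos]
    congr 1
    push_cast
    ring
  rw [multivariateGamma, multivariateGamma, Fin.prod_univ_castSucc, hpi]
  simp only [Fin.val_castSucc, Fin.val_last]
  ring

theorem multivariateGamma_pos {α : ℝ} (hα : ((d : ℝ) - 1) / 2 < α) :
    0 < multivariateGamma d α := by
  refine mul_pos (Real.rpow_pos_of_pos Real.pi_pos _) (Finset.prod_pos fun j _ => ?_)
  have hj : (j : ℝ) + 1 ≤ d := by exact_mod_cast j.isLt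
  exact Real.Gamma_pos_of_pos (by linarith)

/-- The unnormalised Wishart density as a function of the entries on and above the diagonal. -/
def wishartKernel (α : ℝ) (B : Matrix (Fin d) (Fin d) ℝ) (θ : Sym2 (Fin d) → ℝ) : ℝ :=
  (symMatrix θ).det ^ (α - ((d : ℝ) + 1) / 2) * Real.exp (-(B * symMatrix θ).trace)

/-- The unnormalised Wishart density, extended by zero from the positive definite cone. -/
def wishartWeight (α : ℝ) (B : Matrix (Fin d) (Fin d) ℝ) : (Sym2 (Fin d) → ℝ) → ENNReal :=
  {θ | (symMatrix θ).PosDef}.indicator fun θ => ENNReal.ofReal (wishartKernel α B θ)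

theorem wishartWeight_of_posDef {K : Sym2 (Fin d) → ℝ} (hK : (symMatrix K).PosDef) (α : ℝ)
    (B : Matrix (Fin d) (Fin d) ℝ) :
    wishartWeight α B K = ENNReal.ofReal (wishartKernel α B K) :=
  Set.indicator_of_mem (s := {θ | (symMatrix θ).PosDef}) hK _

theorem wishartWeight_of_not_posDef {K : Sym2 (Fin d) → ℝ} (hK : ¬(symMatrix K).PosDef) (α : ℝ)
    (B : Matrix (Fin d) (Fin d) ℝ) : wishartWeight α B K = 0 :=
  Set.indicator_of_notMem (s := {θ | (symMatrix θ).PosDef}) hK _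

theorem measurable_wishartKernel (α : ℝ) (B : Matrix (Fin d) (Fin d) ℝ) :
    Measurable (wishartKernel α B) := by
  have hdet : Continuous fun θ : Sym2 (Fin d) → ℝ => (symMatrix θ).det :=
    continuous_symMatrix.matrix_det
  have htrace : Continuous fun θ : Sym2 (Fin d) → ℝ => (B * symMatrix θ).trace :=
    (continuous_const.matrix_mul continuous_symMatrix).matrix_trace
  exact (hdet.measurable.pow_const _).mul (Real.measurable_exp.comp htrace.measurable.neg)

theorem measurable_wishartWeight (α : ℝ) (B : Matrix (Fin d) (Fin d) ℝ) :
    Measurable (wishartWeight α B) :=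
  (measurable_wishartKernel α B).ennreal_ofReal.indicator
    isOpen_setOf_posDef_symMatrix.measurableSet

theorem wishartWeight_assemble (α b : ℝ) (c : Fin d → ℝ) (B : Matrix (Fin d) (Fin d) ℝ)
    {K : Sym2 (Fin d) → ℝ} (hK : (symMatrix K).PosDef) (u : Fin d → ℝ) (h : ℝ) :
    wishartWeight α (bordered b c B) (assemble d (K, u, h)) =
      ENNReal.ofReal ((symMatrix K).det ^ (α - d / 2 - 1) * Real.exp (-(B * symMatrix K).trace)) *
      ENNReal.ofReal (Real.exp (-(b * (u ⬝ᵥ (symMatrix K)⁻¹ *ᵥ u)) - 2 * (c ⬝ᵥ u))) *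
      (Set.Ioi (0 : ℝ)).indicator
        (fun s => ENNReal.ofReal (s ^ (α - d / 2 - 1) * Real.exp (-(b * s))))
        (h - u ⬝ᵥ (symMatrix K)⁻¹ *ᵥ u) := by
  set q := u ⬝ᵥ (symMatrix K)⁻¹ *ᵥ u with hq
  have hdet := hK.det_pos
  have hposDef : (symMatrix (assemble d (K, u, h))).PosDef ↔ 0 < h - q := by
    rw [symMatrix_assemble, posDef_bordered_iff_of_posDef hK]
  by_cases hs : 0 < h - q
  · have hexp : Real.exp (-(b * h + 2 * (c ⬝ᵥ u) + (B * symMatrix K).trace)) =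
        Real.exp (-(B * symMatrix K).trace) * Real.exp (-(b * q) - 2 * (c ⬝ᵥ u)) *
          Real.exp (-(b * (h - q))) := by
      rw [← Real.exp_add, ← Real.exp_add]
      congr 1
      ring
    have hpow : α - (((d + 1 : ℕ) : ℝ) + 1) / 2 = α - d / 2 - 1 := by push_cast; ring
    rw [wishartWeight_of_posDef (hposDef.2 hs), Set.indicator_of_mem (by exact hs), wishartKernel,
      symMatrix_assemble, trace_bordered_mul, det_bordered hK.isUnit, ← hq, hpow, hexp,
      Real.mul_rpow hdet.le hs.le, ← ENNReal.ofReal_mul (by positivity),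
      ← ENNReal.ofReal_mul (by positivity)]
    congr 1
    ring
  · rw [wishartWeight_of_not_posDef (mt hposDef.1 hs), Set.indicator_of_notMem (by exact hs),
      mul_zero]

theorem lintegral_wishartWeight_diag {α b : ℝ} (hb : 0 < b) (hα : (d : ℝ) / 2 < α)
    (c : Fin d → ℝ) (B : Matrix (Fin d) (Fin d) ℝ) {K : Sym2 (Fin d) → ℝ}
    (hK : (symMatrix K).PosDef) (u : Fin d → ℝ) :
    ∫⁻ h, wishartWeight α (bordered b c B) (assemble d (K, u, h)) =
      ENNReal.ofReal ((symMatrix K).det ^ (α - d / 2 - 1) * Real.exp (-(B * symMatrix K).trace)) *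
      ENNReal.ofReal (Real.exp (-(b * (u ⬝ᵥ (symMatrix K)⁻¹ *ᵥ u)) - 2 * (c ⬝ᵥ u))) *
      ENNReal.ofReal (Real.Gamma (α - d / 2) * b ^ (-(α - d / 2))) := by
  simp_rw [wishartWeight_assemble α b c B hK u]
  rw [lintegral_const_mul' _ _ (ENNReal.mul_ne_top ENNReal.ofReal_ne_top ENNReal.ofReal_ne_top),
    lintegral_sub_right_eq_self (μ := volume) (fun s => (Set.Ioi (0 : ℝ)).indicator _ s),
    lintegral_indicator measurableSet_Ioi, lintegral_Ioi_rpow_mul_exp_neg (by linarith) hb]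

theorem lintegral_wishartWeight_row {α b : ℝ} (hb : 0 < b) (hα : (d : ℝ) / 2 < α)
    (c : Fin d → ℝ) (B : Matrix (Fin d) (Fin d) ℝ) (K : Sym2 (Fin d) → ℝ) :
    ∫⁻ u, ∫⁻ h, wishartWeight α (bordered b c B) (assemble d (K, u, h)) =
      ENNReal.ofReal (Real.pi ^ ((d : ℝ) / 2) * Real.Gamma (α - d / 2) * b ^ (-α)) *
        wishartWeight α (B - b⁻¹ • Matrix.vecMulVec c c) K := by
  by_cases hK : (symMatrix K).PosDef
  · have hdet := hK.det_pos
    simp_rw [lintegral_wishartWeight_diag hb hα c B hK]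
    rw [lintegral_mul_const' _ _ ENNReal.ofReal_ne_top,
      lintegral_const_mul' _ _ ENNReal.ofReal_ne_top,
      lintegral_exp_neg_quadratic_sub_linear hK hb, wishartWeight_of_posDef hK,
      ← ENNReal.ofReal_mul (by positivity), ← ENNReal.ofReal_mul (by positivity),
      ← ENNReal.ofReal_mul (by positivity)]
    congr 1
    have hexp : Real.exp (-((B * symMatrix K).trace - (c ⬝ᵥ symMatrix K *ᵥ c) / b)) =
        Real.exp (-(B * symMatrix K).trace) * Real.exp ((c ⬝ᵥ symMatrix K *ᵥ c) / b) := by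
      rw [← Real.exp_add]
      congr 1
      ring
    have hdetpow : (symMatrix K).det ^ (α - ((d : ℝ) + 1) / 2) =
        (symMatrix K).det ^ (α - d / 2 - 1) * √(symMatrix K).det := by
      rw [Real.sqrt_eq_rpow, ← Real.rpow_add hdet]
      congr 1
      ring
    have hbpow : b ^ (-(α - (d : ℝ) / 2)) = b ^ (-α) * b ^ ((d : ℝ) / 2) := by
      rw [← Real.rpow_add hb]
      congr 1
      ring
    rw [wishartKernel, trace_sub_vecMulVec_mul, hexp, hdetpow, hbpow, Fintype.card_fin,
      Real.div_rpow Real.pi_pos.le hb.le]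
    field_simp
  · have hassemble (u : Fin d → ℝ) (h : ℝ) : ¬(symMatrix (assemble d (K, u, h))).PosDef := by
      rw [symMatrix_assemble]
      exact fun hM => hK (posDef_of_posDef_bordered hM)
    simp only [wishartWeight_of_not_posDef hK, wishartWeight_of_not_posDef (hassemble _ _),
      lintegral_zero, mul_zero]

theorem lintegral_wishartWeight_bordered {α b : ℝ} (hb : 0 < b) (hα : (d : ℝ) / 2 < α)
    (c : Fin d → ℝ) (B : Matrix (Fin d) (Fin d) ℝ) :
    ∫⁻ θ, wishartWeight α (bordered b c B) θ =
      ENNReal.ofReal (Real.pi ^ ((d : ℝ) / 2) * Real.Gamma (α - d / 2) * b ^ (-α)) *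
        ∫⁻ K, wishartWeight α (B - b⁻¹ • Matrix.vecMulVec c c) K := by
  have hmeas := measurable_wishartWeight α (bordered b c B)
  have hmeas' := hmeas.comp measurePreserving_assemble.measurable
  calc ∫⁻ θ, wishartWeight α (bordered b c B) θ
      = ∫⁻ p, wishartWeight α (bordered b c B) (assemble d p) :=
        (measurePreserving_assemble.lintegral_comp hmeas).symm
    _ = ∫⁻ K, ∫⁻ q, wishartWeight α (bordered b c B) (assemble d (K, q)) := by
        rw [Measure.volume_eq_prod]
        exact lintegral_prod _ hmeas'.aemeasurable
    _ = ∫⁻ K, ∫⁻ u, ∫⁻ h, wishartWeight α (bordered b c B) (assemble d (K, u, h)) := by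
        refine lintegral_congr fun K => ?_
        rw [Measure.volume_eq_prod]
        exact lintegral_prod _ (hmeas'.comp measurable_prodMk_left).aemeasurable
    _ = _ := by
        simp_rw [lintegral_wishartWeight_row hb hα c B]
        exact lintegral_const_mul' _ _ ENNReal.ofReal_ne_top

theorem lintegral_wishartWeight (d : ℕ) {α : ℝ} {B : Matrix (Fin d) (Fin d) ℝ}
    (hα : ((d : ℝ) - 1) / 2 < α) (hB : B.PosDef) :
    ∫⁻ θ, wishartWeight α B θ = ENNReal.ofReal (multivariateGamma d α * B.det ^ (-α)) := by
  induction d with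
  | zero =>
    have hposDef (θ : Sym2 (Fin 0) → ℝ) : (symMatrix θ).PosDef :=
      Matrix.PosDef.of_dotProduct_mulVec_pos (isHermitian_symMatrix θ)
        fun x hx => absurd (Subsingleton.elim x 0) hx
    simp_rw [wishartWeight_of_posDef (hposDef _)]
    rw [Measure.volume_pi_eq_dirac]
    simp [wishartKernel, multivariateGamma]
  | succ d ih =>
    obtain ⟨b, c, B', rfl⟩ := exists_bordered_eq hB.isHermitian
    have hb := pos_of_posDef_bordered hB
    have hS := posDef_schur_of_bordered hB
    push_cast at hα
    have hΓ : 0 < Real.Gamma (α - d / 2) := Real.Gamma_pos_of_pos (by linarith)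
    rw [lintegral_wishartWeight_bordered hb (by linarith), ih (by linarith) hS,
      ← ENNReal.ofReal_mul (by positivity), multivariateGamma_succ,
      det_bordered_eq_mul_det_schur hb.ne', Real.mul_rpow hb.le hS.det_pos.le]
    congr 1
    ring

theorem integral_wishartKernel {α : ℝ} {B : Matrix (Fin d) (Fin d) ℝ}
    (hα : ((d : ℝ) - 1) / 2 < α) (hB : B.PosDef) :
    ∫ θ in {θ : Sym2 (Fin d) → ℝ | (symMatrix θ).PosDef}, wishartKernel α B θ =
      multivariateGamma d α * B.det ^ (-α) := by
  have hmeas := isOpen_setOf_posDef_symMatrix (d := d).measurableSet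
  have hΓ := multivariateGamma_pos hα
  have hdet := hB.det_pos
  rw [integral_eq_lintegral_of_nonneg_ae, ← lintegral_indicator hmeas]
  · exact (congrArg ENNReal.toReal (lintegral_wishartWeight d hα hB)).trans
      (ENNReal.toReal_ofReal (by positivity))
  · refine ae_restrict_of_forall_mem hmeas fun θ (hθ : (symMatrix θ).PosDef) => ?_
    have hθdet := hθ.det_pos
    simp only [Pi.zero_apply, wishartKernel]
    positivity
  · exact (measurable_wishartKernel α B).aestronglyMeasurable

end WishartIntegral

/-! ### Closed forms of the evidences -/

section ClosedForms

variable {d : ℕ}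

theorem posSemidef_scatter (n : ℕ) (x : ℕ → EuclideanSpace ℝ (Fin d)) :
    (scatter n x).PosSemidef := by
  have hsum : scatter n x = ∑ i ∈ Finset.range n,
      Matrix.vecMulVec (fun j => x i j) (star fun j => x i j) := by
    ext j k
    simp [scatter, Matrix.sum_apply, Matrix.vecMulVec_apply]
  rw [hsum]
  exact Matrix.posSemidef_sum _ fun i _ => Matrix.posSemidef_vecMulVec_self_star _

theorem pi_rpow_mul_card_div_two (n : ℕ) (d : ℕ) :
    Real.pi ^ ((n : ℝ) * d / 2) = ∏ _j : Fin d, Real.pi ^ ((n : ℝ) / 2) := by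
  rw [Finset.prod_const, Finset.card_univ, Fintype.card_fin, ← Real.rpow_mul_natCast Real.pi_pos.le,
    mul_div_right_comm]

theorem likelihood_diagonal {η : Fin d → ℝ} (hη : ∀ j, 0 ≤ η j) (n : ℕ)
    (x : ℕ → EuclideanSpace ℝ (Fin d)) :
    likelihood (Matrix.diagonal η) n x =
      ∏ j, η j ^ ((n : ℝ) / 2) / Real.pi ^ ((n : ℝ) / 2) *
        Real.exp (-(η j * scatter n x j j)) := by
  rw [likelihood, Matrix.det_diagonal, ← Real.finsetProd_rpow _ _ fun j _ => hη j,
    pi_rpow_mul_card_div_two, Finset.prod_mul_distrib, Finset.prod_div_distrib, ← Real.exp_sum,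
    Finset.sum_neg_distrib]
  simp only [Matrix.trace, Matrix.diag_apply, Matrix.diagonal_mul]

theorem likelihood_smul_one {η : ℝ} (hη : 0 ≤ η) (n : ℕ) (x : ℕ → EuclideanSpace ℝ (Fin d)) :
    likelihood (η • (1 : Matrix (Fin d) (Fin d) ℝ)) n x =
      η ^ ((n : ℝ) * d / 2) / Real.pi ^ ((n : ℝ) * d / 2) *
        Real.exp (-(η * (scatter n x).trace)) := by
  have hdet : (η • (1 : Matrix (Fin d) (Fin d) ℝ)).det ^ ((n : ℝ) / 2) =
      η ^ ((n : ℝ) * d / 2) := by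
    rw [Matrix.det_smul, Matrix.det_one, mul_one, Fintype.card_fin, ← Real.rpow_natCast_mul hη]
    ring_nf
  rw [likelihood, hdet, Matrix.smul_mul, Matrix.one_mul, Matrix.trace_smul, smul_eq_mul]

theorem likelihood_mul_wishartDensity {θ : Sym2 (Fin d) → ℝ} (hθ : (symMatrix θ).PosDef) (α : ℝ)
    (B : Matrix (Fin d) (Fin d) ℝ) (n : ℕ) (x : ℕ → EuclideanSpace ℝ (Fin d)) :
    likelihood (symMatrix θ) n x * wishartDensity α B (symMatrix θ) =
      B.det ^ α / (multivariateGamma d α * Real.pi ^ ((n : ℝ) * d / 2)) *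
        wishartKernel (α + n / 2) (B + scatter n x) θ := by
  have hpow : (symMatrix θ).det ^ (α + n / 2 - ((d : ℝ) + 1) / 2) =
      (symMatrix θ).det ^ ((n : ℝ) / 2) * (symMatrix θ).det ^ (α - ((d : ℝ) + 1) / 2) := by
    rw [← Real.rpow_add hθ.det_pos]
    ring_nf
  have hexp : Real.exp (-((B + scatter n x) * symMatrix θ).trace) =
      Real.exp (-(symMatrix θ * scatter n x).trace) * Real.exp (-(B * symMatrix θ).trace) := by
    rw [← Real.exp_add, Matrix.add_mul, Matrix.trace_add, Matrix.trace_mul_comm (scatter n x)]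
    ring_nf
  rw [likelihood, wishartDensity, wishartKernel, hpow, hexp]
  ring

theorem evidenceA_eq {α : ℝ} {B : Matrix (Fin d) (Fin d) ℝ} (hα : ((d : ℝ) - 1) / 2 < α)
    (hB : B.PosDef) (n : ℕ) (x : ℕ → EuclideanSpace ℝ (Fin d)) :
    evidenceA α B n x = B.det ^ α / (multivariateGamma d α * Real.pi ^ ((n : ℝ) * d / 2)) *
      (multivariateGamma d (α + n / 2) * (B + scatter n x).det ^ (-(α + n / 2))) := by
  have hα' : ((d : ℝ) - 1) / 2 < α + n / 2 := hα.trans_le (le_add_of_nonneg_right (by positivity))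
  rw [← integral_wishartKernel hα' (hB.add_posSemidef (posSemidef_scatter n x)),
    ← integral_const_mul]
  exact setIntegral_congr_fun isOpen_setOf_posDef_symMatrix.measurableSet
    fun θ hθ => likelihood_mul_wishartDensity hθ α B n x

theorem integral_rpow_mul_exp_neg_mul_gammaPDFReal {α β m s : ℝ} (hm : 0 < α + m)
    (hs : 0 < β + s) :
    ∫ η in Set.Ioi (0 : ℝ), η ^ m * Real.exp (-(η * s)) * gammaPDFReal α β η =
      β ^ α / Real.Gamma α * (Real.Gamma (α + m) * (β + s) ^ (-(α + m))) := by
  rw [← integral_Ioi_rpow_mul_exp_neg hm hs, ← integral_const_mul]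
  refine setIntegral_congr_fun measurableSet_Ioi fun η (hη : 0 < η) => ?_
  have hpow : η ^ (α + m - 1) = η ^ m * η ^ (α - 1) := by
    rw [← Real.rpow_add hη]
    ring_nf
  have hexp : Real.exp (-((β + s) * η)) = Real.exp (-(η * s)) * Real.exp (-(β * η)) := by
    rw [← Real.exp_add]
    ring_nf
  simp only [gammaPDFReal, if_pos hη.le, hpow, hexp]
  ring

theorem evidenceD_eq {α : ℝ} {β : Fin d → ℝ} (hα : 0 < α) (hβ : ∀ j, 0 < β j) (n : ℕ)
    (x : ℕ → EuclideanSpace ℝ (Fin d)) :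
    evidenceD α β n x = ∏ j, (β j ^ α / (Real.Gamma α * Real.pi ^ ((n : ℝ) / 2)) *
      (Real.Gamma (α + n / 2) * (β j + scatter n x j j) ^ (-(α + n / 2)))) := by
  have hset : {η : Fin d → ℝ | ∀ j, 0 < η j} = Set.univ.pi fun _ => Set.Ioi 0 := by
    ext
    simp
  calc evidenceD α β n x
      = ∫ η in Set.univ.pi fun _ : Fin d => Set.Ioi (0 : ℝ), ∏ j, (Real.pi ^ ((n : ℝ) / 2))⁻¹ *
          (η j ^ ((n : ℝ) / 2) * Real.exp (-(η j * scatter n x j j)) *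
            gammaPDFReal α (β j) (η j)) := by
        rw [evidenceD, hset]
        refine setIntegral_congr_fun (.univ_pi fun _ => measurableSet_Ioi) fun η hη => ?_
        simp only [likelihood_diagonal (fun j => (hη j trivial).le), ← Finset.prod_mul_distrib]
        exact Finset.prod_congr rfl fun j _ => by ring
    _ = ∏ j, ∫ η in Set.Ioi (0 : ℝ), (Real.pi ^ ((n : ℝ) / 2))⁻¹ *
          (η ^ ((n : ℝ) / 2) * Real.exp (-(η * scatter n x j j)) *
            gammaPDFReal α (β j) η) := by
        rw [volume_pi, Measure.restrict_pi_pi, ← integral_fintype_prod_eq_prod]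
    _ = _ := by
        refine Finset.prod_congr rfl fun j _ => ?_
        have hs : 0 ≤ scatter n x j j := (posSemidef_scatter n x).diag_nonneg
        rw [integral_const_mul,
          integral_rpow_mul_exp_neg_mul_gammaPDFReal (by positivity) (by linarith [hβ j])]
        field_simp

theorem evidenceC_eq {α β : ℝ} (hα : 0 < α) (hβ : 0 < β) (n : ℕ)
    (x : ℕ → EuclideanSpace ℝ (Fin d)) :
    evidenceC α β n x = β ^ α / (Real.Gamma α * Real.pi ^ ((n : ℝ) * d / 2)) *
      (Real.Gamma (α + n * d / 2) *
        (β + (scatter n x).trace) ^ (-(α + (n : ℝ) * d / 2))) := by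
  calc evidenceC α β n x
      = ∫ η in Set.Ioi (0 : ℝ), (Real.pi ^ ((n : ℝ) * d / 2))⁻¹ *
          (η ^ ((n : ℝ) * d / 2) * Real.exp (-(η * (scatter n x).trace)) *
            gammaPDFReal α β η) := by
        refine setIntegral_congr_fun measurableSet_Ioi fun η (hη : 0 < η) => ?_
        simp only [likelihood_smul_one hη.le]
        ring
    _ = _ := by
        rw [integral_const_mul, integral_rpow_mul_exp_neg_mul_gammaPDFReal (by positivity)
          (by linarith [(posSemidef_scatter n x).trace_nonneg])]
        field_simp

end ClosedForms

/-! ### Stirling's formula -/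

section Stirling

/-- The error in the approximation `(x - 1/2) log x - x` to `log Γ(x)`. -/
def stirlingError (x : ℝ) : ℝ :=
  Real.log (Real.Gamma x) - ((x - 1 / 2) * Real.log x - x)

theorem stirlingError_add_one {x : ℝ} (hx : 0 < x) :
    stirlingError (x + 1) = stirlingError x - ((x + 1 / 2) * Real.log ((x + 1) / x) - 1) := by
  rw [stirlingError, stirlingError, Real.Gamma_add_one hx.ne',
    Real.log_mul hx.ne' (Real.Gamma_pos_of_pos hx).ne', Real.log_div (by positivity) hx.ne']
  ring

theorem one_le_add_half_mul_log {x : ℝ} (hx : 0 < x) :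
    1 ≤ (x + 1 / 2) * Real.log ((x + 1) / x) := by
  have hlog := Real.le_log_one_add_of_nonneg (x := 1 / x) (by positivity)
  have harg : 1 + 1 / x = (x + 1) / x := by field_simp
  have hbound : 2 * (1 / x) / (1 / x + 2) = (x + 1 / 2)⁻¹ := by
    field_simp
    ring
  rwa [harg, hbound, inv_le_iff_one_le_mul₀ (by positivity), mul_comm] at hlog

theorem add_half_mul_log_le {x : ℝ} (hx : 0 < x) :
    (x + 1 / 2) * Real.log ((x + 1) / x) ≤ 1 + (1 / (4 * x) - 1 / (4 * (x + 1))) := by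
  have hone : 1 ≤ (x + 1) / x := by
    rw [le_div_iff₀ hx]
    linarith
  have hsinh := Real.self_le_sinh_iff.2 (Real.log_nonneg hone)
  rw [Real.sinh_log (by positivity)] at hsinh
  calc (x + 1 / 2) * Real.log ((x + 1) / x)
      ≤ (x + 1 / 2) * (((x + 1) / x - ((x + 1) / x)⁻¹) / 2) := by gcongr
    _ = 1 + (1 / (4 * x) - 1 / (4 * (x + 1))) := by
      field_simp
      ring

theorem stirlingError_add_natCast_le {x : ℝ} (hx : 0 < x) (k : ℕ) :
    stirlingError (x + k) ≤ stirlingError x := by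
  induction k with
  | zero => simp
  | succ k ih =>
    have hk : 0 < x + k := by positivity
    rw [Nat.cast_succ, ← add_assoc, stirlingError_add_one hk]
    linarith [one_le_add_half_mul_log hk]

theorem stirlingError_sub_le_add_natCast {x : ℝ} (hx : 0 < x) (k : ℕ) :
    stirlingError x - 1 / (4 * x) ≤ stirlingError (x + k) - 1 / (4 * (x + k)) := by
  induction k with
  | zero => simp
  | succ k ih =>
    have hk : 0 < x + k := by positivity
    rw [Nat.cast_succ, ← add_assoc, stirlingError_add_one hk]
    linarith [add_half_mul_log_le hk]

theorem continuousOn_stirlingError : ContinuousOn stirlingError (Set.Ioi 0) := by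
  intro x (hx : 0 < x)
  have hΓ : ContinuousAt Real.Gamma x :=
    (Real.differentiableAt_Gamma fun m => by
      have : (0 : ℝ) ≤ m := by positivity
      linarith).continuousAt
  exact ((hΓ.log (Real.Gamma_pos_of_pos hx).ne').sub
    (((continuousAt_id.sub continuousAt_const).mul
      (Real.continuousAt_log hx.ne')).sub continuousAt_id)).continuousWithinAt

theorem stirlingError_isBigO_one : stirlingError =O[atTop] (fun _ => (1 : ℝ)) := by
  obtain ⟨M, hM⟩ := isCompact_Icc.exists_bound_of_continuousOn
    (continuousOn_stirlingError.mono fun x (hx : x ∈ Set.Icc 1 2) => one_pos.trans_le hx.1)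
  refine IsBigO.of_bound (M + 1 / 4) ?_
  filter_upwards [eventually_ge_atTop (1 : ℝ)] with x hx
  obtain ⟨y, k, hy1, hy2, rfl⟩ : ∃ (y : ℝ) (k : ℕ), 1 ≤ y ∧ y ≤ 2 ∧ x = y + k := by
    refine ⟨x - ⌊x - 1⌋₊, ⌊x - 1⌋₊, ?_, ?_, by ring⟩
    · linarith [Nat.floor_le (show 0 ≤ x - 1 by linarith)]
    · linarith [Nat.lt_floor_add_one (x - 1)]
  have hy0 : 0 < y := by linarith
  have hupper := stirlingError_add_natCast_le hy0 k
  have hlower := stirlingError_sub_le_add_natCast hy0 k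
  have hy : 1 / (4 * y) ≤ 1 / 4 := by
    gcongr
    linarith
  have hyk : 0 < 1 / (4 * (y + k)) := by positivity
  have hMy := abs_le.1 (hM y ⟨hy1, hy2⟩)
  rw [norm_one, mul_one, Real.norm_eq_abs, abs_le]
  constructor <;> linarith

theorem log_Gamma_add_mul_isBigO (a : ℝ) {c : ℝ} (hc : 0 < c) :
    (fun n : ℕ => Real.log (Real.Gamma (a + c * n)) -
      (c * n * Real.log (c * n) - c * n + (a - 1 / 2) * Real.log n)) =O[atTop]
      (fun _ => (1 : ℝ)) := by
  have hcn : Tendsto (fun n : ℕ => c * (n : ℝ)) atTop atTop :=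
    tendsto_natCast_atTop_atTop.const_mul_atTop hc
  have hacn := tendsto_atTop_add_const_left _ a hcn
  have herror : (fun n : ℕ => stirlingError (a + c * n)) =O[atTop] (fun _ => (1 : ℝ)) :=
    stirlingError_isBigO_one.comp_tendsto hacn
  have hlog₁ : (fun n : ℕ => c * (n : ℝ) * Real.log (1 + a / (c * n))) =O[atTop]
      (fun _ => (1 : ℝ)) :=
    ((Real.tendsto_mul_log_one_add_div_atTop a).comp hcn).isBigO_one ℝ
  have hlog₂ : (fun n : ℕ => Real.log (c + a / (n : ℝ))) =O[atTop] (fun _ => (1 : ℝ)) := by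
    have hlim : Tendsto (fun n : ℕ => c + a / (n : ℝ)) atTop (𝓝 c) := by
      simpa using (tendsto_const_div_atTop_nhds_zero_nat a).const_add c
    exact (hlim.log hc.ne').isBigO_one ℝ
  have hconst : (fun _ : ℕ => a) =O[atTop] (fun _ => (1 : ℝ)) :=
    isBigO_const_const _ one_ne_zero _
  refine (((herror.add hlog₁).add (hlog₂.const_mul_left (a - 1 / 2))).sub hconst).congr' ?_ .rfl
  filter_upwards [hacn.eventually_gt_atTop 0, eventually_gt_atTop 0] with n hn hn0
  have hn0' : (0 : ℝ) < n := by exact_mod_cast hn0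
  have harg₁ : 1 + a / (c * n) = (a + c * n) / (c * n) := by
    field_simp
    ring
  have harg₂ : c + a / (n : ℝ) = (a + c * n) / n := by
    field_simp
    ring
  rw [harg₁, harg₂, Real.log_div hn.ne' (by positivity), Real.log_div hn.ne' hn0'.ne',
    stirlingError]
  ring

end Stirling

/-! ### Asymptotics of smooth functions -/

section Calculus

variable {E : Type*} [NormedAddCommGroup E] [NormedSpace ℝ E]

theorem isBigO_norm_sub_sq_of_fderiv_eq_zero {f : E → ℝ} {x₀ : E} (hf : ContDiffAt ℝ 2 f x₀)
    (hcrit : fderiv ℝ f x₀ = 0) :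
    (fun x => f x - f x₀) =O[𝓝 x₀] fun x => ‖x - x₀‖ ^ 2 := by
  have hderiv : fderiv ℝ f =O[𝓝 x₀] fun x => x - x₀ := by
    have hdiff : DifferentiableAt ℝ (fderiv ℝ f) x₀ :=
      (hf.fderiv_right (m := 1) (by norm_num)).differentiableAt one_ne_zero
    simpa only [hcrit, sub_zero] using hdiff.isBigO_sub
  obtain ⟨C, hC, hbound⟩ := hderiv.exists_nonneg
  have hdiff : ∀ᶠ x in 𝓝 x₀, DifferentiableAt ℝ f x :=
    (hf.eventually (by simp)).mono fun x hx => hx.differentiableAt (by norm_num)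
  obtain ⟨r, hr, hball⟩ := Metric.eventually_nhds_iff_ball.1 (hbound.bound.and hdiff)
  refine IsBigO.of_bound C ?_
  filter_upwards [Metric.ball_mem_nhds x₀ hr] with x hx
  have hsub : Metric.closedBall x₀ ‖x - x₀‖ ⊆ Metric.ball x₀ r :=
    Metric.closedBall_subset_ball (mem_ball_iff_norm.1 hx)
  have hmean : ‖f x - f x₀‖ ≤ C * ‖x - x₀‖ * ‖x - x₀‖ :=
    (convex_closedBall x₀ ‖x - x₀‖).norm_image_sub_le_of_norm_fderiv_le (𝕜 := ℝ)
      (fun y hy => (hball y (hsub hy)).2)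
      (fun y hy => (hball y (hsub hy)).1.trans
        (mul_le_mul_of_nonneg_left (mem_closedBall_iff_norm.1 hy) hC))
      (Metric.mem_closedBall_self (norm_nonneg _)) (mem_closedBall_iff_norm.2 le_rfl)
  rwa [norm_pow, norm_norm, sq, ← mul_assoc]

theorem tendsto_add_inv_smul {x₀ : E} {u : ℕ → E} (hu : Tendsto u atTop (𝓝 x₀)) (b : E) :
    Tendsto (fun n : ℕ => u n + (n : ℝ)⁻¹ • b) atTop (𝓝 x₀) := by
  simpa using hu.add ((tendsto_inv_atTop_nhds_zero_nat (𝕜 := ℝ)).smul_const b)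

theorem isBigO_natCast_mul_sub {f : E → ℝ} {x₀ : E} (hf : ContDiffAt ℝ 1 f x₀) {u : ℕ → E}
    (hu : Tendsto u atTop (𝓝 x₀)) (b : E) :
    (fun n : ℕ => (n : ℝ) * (f (u n + (n : ℝ)⁻¹ • b) - f (u n))) =O[atTop]
      (fun _ => (1 : ℝ)) := by
  have hlip : (fun n : ℕ => f (u n + (n : ℝ)⁻¹ • b) - f (u n)) =O[atTop]
      fun n => u n + (n : ℝ)⁻¹ • b - u n :=
    (hf.hasStrictFDerivAt one_ne_zero).isBigO_sub.comp_tendsto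
      ((tendsto_add_inv_smul hu b).prodMk_nhds hu)
  refine ((isBigO_refl (fun n : ℕ => (n : ℝ)) atTop).mul hlip.norm_right).trans
    (.of_bound ‖b‖ (.of_forall fun n => ?_))
  simp only [add_sub_cancel_left, norm_smul, norm_mul, norm_norm, norm_inv, Real.norm_natCast,
    norm_one, mul_one]
  by_cases hn : (n : ℝ) = 0
  · simp [hn]
  · rw [mul_inv_cancel_left₀ hn]

end Calculus

/-! ### Laplace expansion of the evidences -/

section Criteria

variable {d : ℕ} {θ : Sym2 (Fin d) → ℝ} {m : WithTop ℕ∞}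

/-- Twice the minimised negative log-likelihood per observation of the general model, up to an
additive constant common to all models, as a function of the second moments. -/
def critA (θ : Sym2 (Fin d) → ℝ) : ℝ := Real.log (symMatrix θ).det

/-- The analogue of `critA` for the diagonal model. -/
def critD (θ : Sym2 (Fin d) → ℝ) : ℝ := ∑ j, Real.log (θ s(j, j))

/-- The analogue of `critA` for the isotropic model. -/
def critC (θ : Sym2 (Fin d) → ℝ) : ℝ := d * Real.log ((∑ j, θ s(j, j)) / d)

theorem contDiffAt_critA (hθ : (symMatrix θ).PosDef) : ContDiffAt ℝ m critA θ := by
  have hdet : ContDiff ℝ m fun θ : Sym2 (Fin d) → ℝ => (symMatrix θ).det := by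
    simp only [Matrix.det_apply, symMatrix_apply]
    exact ContDiff.sum fun σ _ => (contDiff_prod fun i _ => contDiff_apply ℝ ℝ _).const_smul _
  exact hdet.contDiffAt.log hθ.det_pos.ne'

theorem contDiffAt_critD (hθ : ∀ j, 0 < θ s(j, j)) : ContDiffAt ℝ m critD θ :=
  ContDiffAt.sum fun j _ => (contDiff_apply ℝ ℝ s(j, j)).contDiffAt.log (hθ j).ne'

theorem contDiffAt_critC (hθ : 0 < (∑ j, θ s(j, j)) / d) : ContDiffAt ℝ m critC θ := by
  have hmean : ContDiff ℝ m fun θ : Sym2 (Fin d) → ℝ => (∑ j, θ s(j, j)) / d :=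
    (ContDiff.sum fun j _ => contDiff_apply ℝ ℝ s(j, j)).div_const _
  exact contDiffAt_const.mul (hmean.contDiffAt.log hθ.ne')

theorem diag_pos_of_posDef_symMatrix (hθ : (symMatrix θ).PosDef) (j : Fin d) : 0 < θ s(j, j) :=
  hθ.diag_pos (i := j)

theorem mean_pos_of_posDef_symMatrix [NeZero d] (hθ : (symMatrix θ).PosDef) :
    0 < (∑ j, θ s(j, j)) / d := by
  simpa only [Fintype.card_fin, trace_symMatrix] using trace_div_card_pos hθ

theorem critA_le_critD (hθ : (symMatrix θ).PosDef) : critA θ ≤ critD θ :=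
  log_det_le_sum_log_diag hθ

theorem critD_le_critC [NeZero d] (hθ : ∀ j, 0 < θ s(j, j)) : critD θ ≤ critC θ := by
  have hmean := log_det_le_card_mul_log_mean (Matrix.PosDef.diagonal hθ)
  rwa [Matrix.det_diagonal, Matrix.trace_diagonal, Real.log_prod fun j _ => (hθ j).ne',
    Fintype.card_fin] at hmean

theorem critD_eq_critA_of_isDiag (hθ : (symMatrix θ).PosDef) (hdiag : (symMatrix θ).IsDiag) :
    critD θ = critA θ := by
  have hdet : (symMatrix θ).det = ∏ j, θ s(j, j) := by
    rw [← hdiag.diagonal_diag, Matrix.det_diagonal]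
    rfl
  rw [critD, critA, hdet, Real.log_prod fun j _ => (diag_pos_of_posDef_symMatrix hθ j).ne']

theorem critC_eq_critD_of_diag_eq [NeZero d] {v : ℝ} (hv : ∀ j, θ s(j, j) = v) :
    critC θ = critD θ := by
  simp only [critC, critD, hv, Finset.sum_const, Finset.card_univ, Fintype.card_fin, nsmul_eq_mul,
    mul_div_cancel_left₀ v (NeZero.ne (d : ℝ))]

theorem sub_isBigO_norm_sub_sq_of_le {f g : (Sym2 (Fin d) → ℝ) → ℝ}
    (hf : ContDiffAt ℝ 2 f θ) (hg : ContDiffAt ℝ 2 g θ) (hle : ∀ᶠ x in 𝓝 θ, g x ≤ f x)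
    (heq : f θ = g θ) : (fun x => f x - g x) =O[𝓝 θ] fun x => ‖x - θ‖ ^ 2 := by
  have hmin : IsLocalMin (fun x => f x - g x) θ := by
    filter_upwards [hle] with x hx
    simpa [heq] using hx
  simpa [heq] using isBigO_norm_sub_sq_of_fderiv_eq_zero (hf.sub hg) hmin.fderiv_eq_zero

theorem critD_sub_critA_isBigO (hθ : (symMatrix θ).PosDef) (hdiag : (symMatrix θ).IsDiag) :
    (fun x => critD x - critA x) =O[𝓝 θ] fun x => ‖x - θ‖ ^ 2 :=
  sub_isBigO_norm_sub_sq_of_le (contDiffAt_critD (diag_pos_of_posDef_symMatrix hθ))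
    (contDiffAt_critA hθ)
    (mem_of_superset (isOpen_setOf_posDef_symMatrix.mem_nhds hθ) fun _ hx => critA_le_critD hx)
    (critD_eq_critA_of_isDiag hθ hdiag)

theorem critC_sub_critD_isBigO [NeZero d] (hθ : (symMatrix θ).PosDef) {v : ℝ}
    (hv : ∀ j, θ s(j, j) = v) :
    (fun x => critC x - critD x) =O[𝓝 θ] fun x => ‖x - θ‖ ^ 2 :=
  sub_isBigO_norm_sub_sq_of_le (contDiffAt_critC (mean_pos_of_posDef_symMatrix hθ))
    (contDiffAt_critD (diag_pos_of_posDef_symMatrix hθ))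
    (mem_of_superset (isOpen_setOf_posDef_symMatrix.mem_nhds hθ) fun _ hx =>
      critD_le_critC (diag_pos_of_posDef_symMatrix hx))
    (critC_eq_critD_of_diag_eq hv)

end Criteria

section Empirical

variable {d n : ℕ} {b : Sym2 (Fin d) → ℝ}

/-- The second moments of the first `n` observations, in the coordinates of `symMatrix`. -/
def empirical (n : ℕ) (x : ℕ → EuclideanSpace ℝ (Fin d)) : Sym2 (Fin d) → ℝ :=
  Sym2.lift ⟨fun j k => (∑ i ∈ Finset.range n, x i j * x i k) / n, fun j k => by
    simp only [mul_comm]⟩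

theorem empirical_mk (n : ℕ) (x : ℕ → EuclideanSpace ℝ (Fin d)) (j k : Fin d) :
    empirical n x s(j, k) = (∑ i ∈ Finset.range n, x i j * x i k) / n := rfl

theorem symMatrix_add_scatter (hn : n ≠ 0) (x : ℕ → EuclideanSpace ℝ (Fin d))
    (b : Sym2 (Fin d) → ℝ) :
    symMatrix b + scatter n x = (n : ℝ) • symMatrix (empirical n x + (n : ℝ)⁻¹ • b) := by
  have hn0 : (n : ℝ) ≠ 0 := Nat.cast_ne_zero.2 hn
  have hscatter : (n : ℝ) • symMatrix (empirical n x) = scatter n x := by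
    ext j k
    simp only [Matrix.smul_apply, symMatrix_apply, empirical_mk, scatter, Matrix.of_apply,
      smul_eq_mul, mul_div_cancel₀ _ hn0]
  rw [symMatrix_add, smul_add, hscatter, symMatrix_smul, smul_inv_smul₀ hn0, add_comm]

theorem log_det_symMatrix_add_scatter (hb : (symMatrix b).PosDef) (hn : n ≠ 0)
    (x : ℕ → EuclideanSpace ℝ (Fin d)) :
    Real.log (symMatrix b + scatter n x).det =
      d * Real.log n + critA (empirical n x + (n : ℝ)⁻¹ • b) := by
  have hn0 : (0 : ℝ) < n := by positivity
  have hsum := hb.add_posSemidef (posSemidef_scatter n x)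
  rw [symMatrix_add_scatter hn] at hsum ⊢
  have hpd : (symMatrix (empirical n x + (n : ℝ)⁻¹ • b)).PosDef := by
    simpa only [inv_smul_smul₀ hn0.ne'] using hsum.smul (inv_pos.2 hn0)
  rw [log_det_smul hpd hn0, Fintype.card_fin, critA]

theorem sum_log_add_scatter_diag (hb : ∀ j, 0 < b s(j, j)) (hn : n ≠ 0)
    (x : ℕ → EuclideanSpace ℝ (Fin d)) :
    ∑ j, Real.log (b s(j, j) + scatter n x j j) =
      d * Real.log n + critD (empirical n x + (n : ℝ)⁻¹ • b) := by
  have hn0 : (0 : ℝ) < n := by positivity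
  have hterm (j : Fin d) : Real.log (b s(j, j) + scatter n x j j) =
      Real.log n + Real.log ((empirical n x + (n : ℝ)⁻¹ • b) s(j, j)) := by
    have hs : 0 ≤ scatter n x j j := (posSemidef_scatter n x).diag_nonneg
    have hsum : b s(j, j) + scatter n x j j = n * (empirical n x + (n : ℝ)⁻¹ • b) s(j, j) :=
      congrFun₂ (symMatrix_add_scatter hn x b) j j
    have hpos := add_pos_of_pos_of_nonneg (hb j) hs
    rw [hsum] at hpos ⊢
    exact Real.log_mul hn0.ne' (pos_of_mul_pos_right hpos hn0.le).ne'
  simp only [hterm, critD, Finset.sum_add_distrib, Finset.sum_const, Finset.card_univ,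
    Fintype.card_fin, nsmul_eq_mul]

theorem log_add_trace_scatter [NeZero d] (hb : 0 < ∑ j, b s(j, j)) (hn : n ≠ 0)
    (x : ℕ → EuclideanSpace ℝ (Fin d)) :
    Real.log ((∑ j, b s(j, j)) + (scatter n x).trace) =
      Real.log n + Real.log d + critC (empirical n x + (n : ℝ)⁻¹ • b) / d := by
  have hn0 : (0 : ℝ) < n := by positivity
  have hd0 : (0 : ℝ) < d := Nat.cast_pos.2 (NeZero.pos d)
  have hsum : (∑ j, b s(j, j)) + (scatter n x).trace =
      n * d * ((∑ j, (empirical n x + (n : ℝ)⁻¹ • b) s(j, j)) / d) := by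
    have htrace := congrArg Matrix.trace (symMatrix_add_scatter hn x b)
    rw [Matrix.trace_add, Matrix.trace_smul, trace_symMatrix, trace_symMatrix] at htrace
    rw [htrace, smul_eq_mul, mul_assoc, mul_div_cancel₀ _ hd0.ne']
  have hpos := add_pos_of_pos_of_nonneg hb (posSemidef_scatter n x).trace_nonneg
  rw [hsum] at hpos ⊢
  have hmean := pos_of_mul_pos_right hpos (by positivity)
  rw [Real.log_mul (by positivity) hmean.ne', Real.log_mul hn0.ne' hd0.ne', critC,
    mul_div_cancel_left₀ _ hd0.ne']

end Empirical

section LogEvidence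

variable {d : ℕ}

theorem evidenceA_pos {α : ℝ} {B : Matrix (Fin d) (Fin d) ℝ} (hα : ((d : ℝ) - 1) / 2 < α)
    (hB : B.PosDef) (n : ℕ) (x : ℕ → EuclideanSpace ℝ (Fin d)) : 0 < evidenceA α B n x := by
  have hΓ := multivariateGamma_pos hα
  have hΓn : 0 < multivariateGamma d (α + n / 2) :=
    multivariateGamma_pos (hα.trans_le (le_add_of_nonneg_right (by positivity)))
  have hdet := hB.det_pos
  have hdet_add := (hB.add_posSemidef (posSemidef_scatter n x)).det_pos
  rw [evidenceA_eq hα hB]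
  positivity

theorem evidenceD_pos {α : ℝ} {β : Fin d → ℝ} (hα : 0 < α) (hβ : ∀ j, 0 < β j) (n : ℕ)
    (x : ℕ → EuclideanSpace ℝ (Fin d)) : 0 < evidenceD α β n x := by
  rw [evidenceD_eq hα hβ]
  refine Finset.prod_pos fun j _ => ?_
  have hs : 0 ≤ scatter n x j j := (posSemidef_scatter n x).diag_nonneg
  have hβj := hβ j
  positivity

theorem evidenceC_pos {α β : ℝ} (hα : 0 < α) (hβ : 0 < β) (n : ℕ)
    (x : ℕ → EuclideanSpace ℝ (Fin d)) : 0 < evidenceC α β n x := by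
  rw [evidenceC_eq hα hβ]
  have hs := (posSemidef_scatter n x).trace_nonneg
  positivity

theorem log_rpow_div_mul_mul_rpow_neg {b c g g' t : ℝ} (hb : 0 < b) (hc : 0 < c) (hg : 0 < g)
    (hg' : 0 < g') (ht : 0 < t) (α r : ℝ) :
    Real.log (b ^ α / (g * c) * (g' * t ^ (-r))) =
      α * Real.log b - Real.log g - Real.log c + Real.log g' - r * Real.log t := by
  rw [Real.log_mul (by positivity) (by positivity), Real.log_div (by positivity) (by positivity),
    Real.log_mul hg.ne' hc.ne', Real.log_mul hg'.ne' (by positivity), Real.log_rpow hb,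
    Real.log_rpow ht]
  ring

theorem log_multivariateGamma {α : ℝ} (hα : ((d : ℝ) - 1) / 2 < α) :
    Real.log (multivariateGamma d α) = (d : ℝ) * ((d : ℝ) - 1) / 4 * Real.log Real.pi +
      ∑ j : Fin d, Real.log (Real.Gamma (α - j / 2)) := by
  have hΓ (j : Fin d) : 0 < Real.Gamma (α - j / 2) := by
    have hj : (j : ℝ) + 1 ≤ d := by exact_mod_cast j.isLt
    exact Real.Gamma_pos_of_pos (by linarith)
  rw [multivariateGamma, Real.log_mul (by positivity)
    (Finset.prod_ne_zero_iff.2 fun j _ => (hΓ j).ne'), Real.log_rpow Real.pi_pos,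
    Real.log_prod fun j _ => (hΓ j).ne']

theorem log_evidenceA {α : ℝ} {B : Matrix (Fin d) (Fin d) ℝ} (hα : ((d : ℝ) - 1) / 2 < α)
    (hB : B.PosDef) (n : ℕ) (x : ℕ → EuclideanSpace ℝ (Fin d)) :
    Real.log (evidenceA α B n x) =
      α * Real.log B.det - ∑ j : Fin d, Real.log (Real.Gamma (α - j / 2)) -
        n * d / 2 * Real.log Real.pi +
        ∑ j : Fin d, Real.log (Real.Gamma (α - j / 2 + 1 / 2 * n)) -
        (α + n / 2) * Real.log (B + scatter n x).det := by
  have hαn : ((d : ℝ) - 1) / 2 < α + n / 2 :=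
    hα.trans_le (le_add_of_nonneg_right (by positivity))
  have hshift (j : Fin d) : α + (n : ℝ) / 2 - j / 2 = α - j / 2 + 1 / 2 * n := by ring
  rw [evidenceA_eq hα hB, log_rpow_div_mul_mul_rpow_neg hB.det_pos (by positivity)
    (multivariateGamma_pos hα) (multivariateGamma_pos hαn)
    (hB.add_posSemidef (posSemidef_scatter n x)).det_pos, Real.log_rpow Real.pi_pos,
    log_multivariateGamma hα, log_multivariateGamma hαn]
  simp only [hshift]
  ring

theorem log_evidenceD {α : ℝ} {β : Fin d → ℝ} (hα : 0 < α) (hβ : ∀ j, 0 < β j) (n : ℕ)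
    (x : ℕ → EuclideanSpace ℝ (Fin d)) :
    Real.log (evidenceD α β n x) = α * (∑ j, Real.log (β j)) - d * Real.log (Real.Gamma α) -
      n * d / 2 * Real.log Real.pi + d * Real.log (Real.Gamma (α + 1 / 2 * n)) -
        (α + n / 2) * ∑ j, Real.log (β j + scatter n x j j) := by
  have hfactor (j : Fin d) := log_rpow_div_mul_mul_rpow_neg (hβ j)
    (c := Real.pi ^ ((n : ℝ) / 2)) (by positivity) (Real.Gamma_pos_of_pos hα)
    (Real.Gamma_pos_of_pos (s := α + n / 2) (by positivity))
    (add_pos_of_pos_of_nonneg (hβ j) ((posSemidef_scatter n x).diag_nonneg (i := j))) α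
    (α + n / 2)
  have hne : ∀ j ∈ Finset.univ, β j ^ α / (Real.Gamma α * Real.pi ^ ((n : ℝ) / 2)) *
      (Real.Gamma (α + n / 2) * (β j + scatter n x j j) ^ (-(α + n / 2))) ≠ 0 :=
    Finset.prod_ne_zero_iff.1 (evidenceD_eq hα hβ n x ▸ (evidenceD_pos hα hβ n x).ne')
  rw [evidenceD_eq hα hβ, Real.log_prod hne]
  simp only [hfactor, Real.log_rpow Real.pi_pos, Finset.sum_sub_distrib, Finset.sum_add_distrib,
    ← Finset.mul_sum, Finset.sum_const, Finset.card_univ, Fintype.card_fin, nsmul_eq_mul,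
    one_div_mul_eq_div]
  ring

theorem log_evidenceC {α β : ℝ} (hα : 0 < α) (hβ : 0 < β) (n : ℕ)
    (x : ℕ → EuclideanSpace ℝ (Fin d)) :
    Real.log (evidenceC α β n x) = α * Real.log β - Real.log (Real.Gamma α) -
      n * d / 2 * Real.log Real.pi + Real.log (Real.Gamma (α + d / 2 * n)) -
        (α + n * d / 2) * Real.log (β + (scatter n x).trace) := by
  rw [evidenceC_eq hα hβ, log_rpow_div_mul_mul_rpow_neg hβ (by positivity)
    (Real.Gamma_pos_of_pos hα) (Real.Gamma_pos_of_pos (by positivity))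
    (add_pos_of_pos_of_nonneg hβ (posSemidef_scatter n x).trace_nonneg), Real.log_rpow Real.pi_pos,
    mul_comm (n : ℝ) d, mul_div_right_comm]

end LogEvidence

section Expansion

variable {d : ℕ} {θ₀ : Sym2 (Fin d) → ℝ} {x : ℕ → EuclideanSpace ℝ (Fin d)}

/-- The coefficient of `-n` in the expansion of the log evidence; it is common to all models. -/
def entropyRate (d : ℕ) : ℝ := d / 2 * (Real.log Real.pi + Real.log 2 + 1)

/-- A sequence `E` of evidences of `d`-dimensional observations whose logarithm is, up to a bounded
error, that of a regular model with `p` parameters and criterion values `L n`. -/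
def HasLaplaceExpansion (d : ℕ) (p : ℝ) (E L : ℕ → ℝ) : Prop :=
  (fun n : ℕ => Real.log (E n) + entropyRate d * n + p / 2 * Real.log n + n / 2 * L n) =O[atTop]
    (fun _ => (1 : ℝ))

/-- What the prior contributes to the expansion of the log evidence: `b` is its rate, which shifts
the empirical second moments by `b / n`, and `a` its shape. -/
theorem isBigO_prior_terms {f : (Sym2 (Fin d) → ℝ) → ℝ} (hf : ContDiffAt ℝ 1 f θ₀)
    {u : ℕ → Sym2 (Fin d) → ℝ} (hu : Tendsto u atTop (𝓝 θ₀)) (b : Sym2 (Fin d) → ℝ) (a k : ℝ) :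
    (fun n : ℕ => k - a * f (u n + (n : ℝ)⁻¹ • b) -
      1 / 2 * ((n : ℝ) * (f (u n + (n : ℝ)⁻¹ • b) - f (u n)))) =O[atTop] (fun _ => (1 : ℝ)) := by
  have hconst : (fun _ : ℕ => k) =O[atTop] (fun _ => (1 : ℝ)) :=
    isBigO_const_const _ one_ne_zero _
  have hvalue : (fun n : ℕ => f (u n + (n : ℝ)⁻¹ • b)) =O[atTop] (fun _ => (1 : ℝ)) :=
    (hf.continuousAt.tendsto.comp (tendsto_add_inv_smul hu b)).isBigO_one ℝ
  exact (hconst.sub (hvalue.const_mul_left a)).sub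
    ((isBigO_natCast_mul_sub hf hu b).const_mul_left (1 / 2))

theorem sum_fin_sub_half (d : ℕ) (a : ℝ) :
    ∑ j : Fin d, (a - (j : ℝ) / 2) = d * a - (d : ℝ) * ((d : ℝ) - 1) / 4 := by
  rw [Finset.sum_sub_distrib, ← Finset.sum_div, Fin.sum_univ_eq_sum_range (fun j => (j : ℝ)),
    ← Nat.cast_sum, Finset.sum_range_id, ← Nat.choose_two_right, Nat.cast_choose_two,
    Finset.sum_const, Finset.card_univ, Fintype.card_fin, nsmul_eq_mul]
  ring

theorem hasLaplaceExpansion_evidenceA {α : ℝ} {B : Matrix (Fin d) (Fin d) ℝ}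
    (hα : ((d : ℝ) - 1) / 2 < α) (hB : B.PosDef) (hθ : (symMatrix θ₀).PosDef)
    (hx : Tendsto (fun n => empirical n x) atTop (𝓝 θ₀)) :
    HasLaplaceExpansion d (d * (d + 1) / 2) (fun n => evidenceA α B n x)
      fun n => critA (empirical n x) := by
  obtain ⟨b, rfl⟩ := exists_symMatrix_eq hB.isHermitian
  have hΓ : (fun n : ℕ => ∑ j : Fin d, (Real.log (Real.Gamma (α - j / 2 + 1 / 2 * n)) -
      (1 / 2 * n * Real.log (1 / 2 * n) - 1 / 2 * n +
        (α - j / 2 - 1 / 2) * Real.log n))) =O[atTop] (fun _ => (1 : ℝ)) :=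
    IsBigO.fun_sum fun j _ => log_Gamma_add_mul_isBigO (α - (j : ℝ) / 2) (c := 1 / 2) (by norm_num)
  refine (hΓ.add (isBigO_prior_terms (contDiffAt_critA hθ) hx b α
    (α * Real.log (symMatrix b).det -
      ∑ j : Fin d, Real.log (Real.Gamma (α - j / 2))))).congr' ?_ .rfl
  filter_upwards [eventually_ne_atTop 0] with n hn
  have hsum : ∑ j : Fin d, (α - (j : ℝ) / 2 - 1 / 2) =
      d * (α - 1 / 2) - (d : ℝ) * ((d : ℝ) - 1) / 4 := by
    simpa only [sub_right_comm] using sum_fin_sub_half d (α - 1 / 2)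
  rw [log_evidenceA hα hB, log_det_symMatrix_add_scatter hB hn, Finset.sum_sub_distrib,
    Finset.sum_add_distrib, ← Finset.sum_mul, hsum, one_div_mul_eq_div,
    Real.log_div (Nat.cast_ne_zero.2 hn) two_ne_zero, Finset.sum_const, Finset.card_univ,
    Fintype.card_fin, nsmul_eq_mul, entropyRate]
  ring

theorem hasLaplaceExpansion_evidenceD {α : ℝ} {β : Fin d → ℝ} (hα : 0 < α) (hβ : ∀ j, 0 < β j)
    (hθ : (symMatrix θ₀).PosDef) (hx : Tendsto (fun n => empirical n x) atTop (𝓝 θ₀)) :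
    HasLaplaceExpansion d d (fun n => evidenceD α β n x) fun n => critD (empirical n x) := by
  obtain ⟨b, hb⟩ := exists_symMatrix_eq (Matrix.isHermitian_diagonal β)
  obtain rfl : (fun j => b s(j, j)) = β := by
    ext j
    rw [← symMatrix_apply b, hb, Matrix.diagonal_apply_eq]
  have hΓ := (log_Gamma_add_mul_isBigO α (c := 1 / 2) (by norm_num)).const_mul_left (d : ℝ)
  refine (hΓ.add (isBigO_prior_terms (contDiffAt_critD (diag_pos_of_posDef_symMatrix hθ)) hx b α
    (α * (∑ j, Real.log (b s(j, j))) - d * Real.log (Real.Gamma α)))).congr' ?_ .rfl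
  filter_upwards [eventually_ne_atTop 0] with n hn
  rw [log_evidenceD hα hβ, sum_log_add_scatter_diag hβ hn, one_div_mul_eq_div,
    Real.log_div (Nat.cast_ne_zero.2 hn) two_ne_zero, entropyRate]
  ring

theorem hasLaplaceExpansion_evidenceC [NeZero d] {α β : ℝ} (hα : 0 < α) (hβ : 0 < β)
    (hθ : (symMatrix θ₀).PosDef) (hx : Tendsto (fun n => empirical n x) atTop (𝓝 θ₀)) :
    HasLaplaceExpansion d 1 (fun n => evidenceC α β n x) fun n => critC (empirical n x) := by
  have hd0 : (d : ℝ) ≠ 0 := NeZero.ne _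
  obtain ⟨b, hb⟩ := exists_symMatrix_eq (Matrix.isHermitian_diagonal fun _ : Fin d => β / d)
  obtain rfl : ∑ j, b s(j, j) = β := by
    rw [← trace_symMatrix, hb, Matrix.trace_diagonal, Finset.sum_const, Finset.card_univ,
      Fintype.card_fin, nsmul_eq_mul, mul_div_cancel₀ _ hd0]
  have hΓ := log_Gamma_add_mul_isBigO α (c := d / 2) (by positivity)
  refine (hΓ.add (isBigO_prior_terms (contDiffAt_critC (mean_pos_of_posDef_symMatrix hθ)) hx b
    (α / d) (α * Real.log (∑ j, b s(j, j)) - Real.log (Real.Gamma α) -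
      α * Real.log d))).congr' ?_ .rfl
  filter_upwards [eventually_ne_atTop 0] with n hn
  have hlog : Real.log (d / 2 * n) = Real.log d - Real.log 2 + Real.log n := by
    rw [Real.log_mul (div_ne_zero hd0 two_ne_zero) (Nat.cast_ne_zero.2 hn),
      Real.log_div hd0 two_ne_zero]
  rw [log_evidenceC hα hβ, log_add_trace_scatter hβ hn, hlog, entropyRate]
  field_simp
  ring

end Expansion

section Ratio

variable {d : ℕ} {p p' : ℝ} {E E' L L' : ℕ → ℝ}

theorem tendsto_inv_mul_of_isBigO_one {a f : ℕ → ℝ} (ha : Tendsto a atTop atTop)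
    (hf : f =O[atTop] fun _ => (1 : ℝ)) : Tendsto (fun n => (a n)⁻¹ * f n) atTop (𝓝 0) := by
  have hinv : (fun n => (a n)⁻¹) =o[atTop] fun _ => (1 : ℝ) :=
    (isLittleO_one_iff ℝ).2 ha.inv_tendsto_atTop
  exact (isLittleO_one_iff ℝ).1 (by simpa only [mul_one] using hinv.mul_isBigO hf)

theorem tendsto_log_natCast_atTop : Tendsto (fun n : ℕ => Real.log n) atTop atTop :=
  Real.tendsto_log_atTop.comp tendsto_natCast_atTop_atTop

theorem HasLaplaceExpansion.log_div (h : HasLaplaceExpansion d p E L)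
    (h' : HasLaplaceExpansion d p' E' L') (hE : ∀ n, 0 < E n) (hE' : ∀ n, 0 < E' n) :
    (fun n : ℕ => Real.log (E n / E' n) - (-((p - p') / 2) * Real.log n +
      n / 2 * (L' n - L n))) =O[atTop] (fun _ => (1 : ℝ)) := by
  refine (h.sub h').congr_left fun n => ?_
  rw [Real.log_div (hE n).ne' (hE' n).ne']
  ring

theorem HasLaplaceExpansion.tendsto_linear (h : HasLaplaceExpansion d p E L)
    (h' : HasLaplaceExpansion d p' E' L') (hE : ∀ n, 0 < E n) (hE' : ∀ n, 0 < E' n) {l l' : ℝ}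
    (hL : Tendsto L atTop (𝓝 l)) (hL' : Tendsto L' atTop (𝓝 l')) :
    Tendsto (fun n : ℕ => (n : ℝ)⁻¹ * Real.log (E n / E' n)) atTop (𝓝 (1 / 2 * (l' - l))) := by
  have hremainder := tendsto_inv_mul_of_isBigO_one tendsto_natCast_atTop_atTop
    (h.log_div h' hE hE')
  have hlog : Tendsto (fun n : ℕ => -((p - p') / 2) * (Real.log n / n)) atTop (𝓝 0) := by
    simpa using ((Real.isLittleO_log_id_atTop.tendsto_div_nhds_zero).comp
      tendsto_natCast_atTop_atTop).const_mul (-((p - p') / 2))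
  have hlinear := (hL'.sub hL).const_mul (1 / 2)
  have hsum := (hremainder.add hlog).add hlinear
  rw [zero_add, zero_add] at hsum
  refine hsum.congr' ?_
  filter_upwards [eventually_ne_atTop 0] with n hn
  field_simp
  ring

theorem HasLaplaceExpansion.tendsto_log (h : HasLaplaceExpansion d p E L)
    (h' : HasLaplaceExpansion d p' E' L') (hE : ∀ n, 0 < E n) (hE' : ∀ n, 0 < E' n)
    {ns : ℕ → ℕ} (hns : Tendsto ns atTop atTop)
    (hL : Tendsto (fun i => (Real.log (ns i))⁻¹ * (ns i * (L' (ns i) - L (ns i)))) atTop (𝓝 0)) :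
    Tendsto (fun i => (Real.log (ns i))⁻¹ * Real.log (E (ns i) / E' (ns i))) atTop
      (𝓝 (-((p - p') / 2))) := by
  have hremainder := (tendsto_inv_mul_of_isBigO_one tendsto_log_natCast_atTop
    (h.log_div h' hE hE')).comp hns
  have hsum := (hremainder.add_const (-((p - p') / 2))).add (hL.const_mul (1 / 2))
  rw [mul_zero, zero_add, add_zero] at hsum
  refine hsum.congr' ?_
  filter_upwards [hns.eventually (tendsto_log_natCast_atTop.eventually_ne_atTop 0)] with i hi
  rw [Function.comp_apply]
  field_simp
  ring

end Ratio

section Measurability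

variable {d : ℕ}

theorem measurable_scatter (n : ℕ) (j k : Fin d) :
    Measurable fun x : ℕ → EuclideanSpace ℝ (Fin d) => scatter n x j k := by
  simp only [scatter, Matrix.of_apply]
  fun_prop

theorem measurable_empirical (n : ℕ) :
    Measurable (empirical n : (ℕ → EuclideanSpace ℝ (Fin d)) → Sym2 (Fin d) → ℝ) := by
  refine measurable_pi_lambda _ fun z => ?_
  induction z with
  | h j k => exact (measurable_scatter n j k).div_const _

theorem measurable_evidenceA {α : ℝ} {B : Matrix (Fin d) (Fin d) ℝ}
    (hα : ((d : ℝ) - 1) / 2 < α) (hB : B.PosDef) (n : ℕ) : Measurable (evidenceA α B n) := by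
  have hscatter (j k : Fin d) := measurable_scatter n j k
  simp only [funext fun x => evidenceA_eq hα hB n x, Matrix.det_apply', Matrix.add_apply]
  fun_prop

theorem measurable_evidenceD {α : ℝ} {β : Fin d → ℝ} (hα : 0 < α) (hβ : ∀ j, 0 < β j) (n : ℕ) :
    Measurable (evidenceD α β n) := by
  have hscatter (j k : Fin d) := measurable_scatter n j k
  simp only [funext fun x => evidenceD_eq hα hβ n x]
  fun_prop

theorem measurable_evidenceC {α β : ℝ} (hα : 0 < α) (hβ : 0 < β) (n : ℕ) :
    Measurable (evidenceC (d := d) α β n) := by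
  have hscatter (j k : Fin d) := measurable_scatter n j k
  simp only [funext fun x => evidenceC_eq hα hβ n x, Matrix.trace, Matrix.diag_apply]
  fun_prop

end Measurability

section MeasureConvergence

variable {Ω : Type*} [MeasurableSpace Ω] {P : Measure Ω}

theorem tendstoInMeasure_mul_of_eLpNorm_one_le {a : ℕ → ℝ} (ha : Tendsto a atTop (𝓝 0))
    {Y : ℕ → Ω → ℝ} (hY : ∀ n, AEStronglyMeasurable (Y n) P) {C : ENNReal} (hC : C ≠ ⊤)
    (hbound : ∀ᶠ n in atTop, eLpNorm (Y n) 1 P ≤ C) :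
    TendstoInMeasure P (fun n ω => a n * Y n ω) atTop fun _ => 0 := by
  have hlim : Tendsto (fun n => ‖a n‖ₑ * C) atTop (𝓝 0) := by
    simpa using ENNReal.Tendsto.mul_const ha.enorm (Or.inr hC)
  refine tendstoInMeasure_of_tendsto_eLpNorm one_ne_zero (fun n => (hY n).const_mul _)
    aestronglyMeasurable_const
    (tendsto_of_tendsto_of_tendsto_of_le_of_le' tendsto_const_nhds hlim
      (Eventually.of_forall fun _ => zero_le) ?_)
  filter_upwards [hbound] with n hn
  calc eLpNorm ((fun ω => a n * Y n ω) - fun _ => 0) 1 P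
      = eLpNorm (a n • Y n) 1 P := congrArg (eLpNorm · 1 P) (sub_zero _)
    _ = ‖a n‖ₑ * eLpNorm (Y n) 1 P := eLpNorm_const_smul _ _ _ _
    _ ≤ ‖a n‖ₑ * C := by gcongr

theorem eLpNorm_natCast_mul_sq_average_sub [IsProbabilityMeasure P] {Y : ℕ → Ω → ℝ}
    (hindep : Pairwise fun i j => IndepFun (Y i) (Y j) P)
    (hident : ∀ i, IdentDistrib (Y i) (Y 0) P P) (hL2 : MemLp (Y 0) 2 P) {n : ℕ} (hn : n ≠ 0) :
    eLpNorm (fun ω => (n : ℝ) * ((∑ i ∈ Finset.range n, Y i ω) / n - ∫ ω, Y 0 ω ∂P) ^ 2) 1 P =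
      ENNReal.ofReal Var[Y 0; P] := by
  have hYL2 (i : ℕ) : MemLp (Y i) 2 P := (hident i).memLp_iff.2 hL2
  set S : Ω → ℝ := ∑ i ∈ Finset.range n, Y i with hS
  have hSL2 : MemLp S 2 P := memLp_finsetSum' _ fun i _ => hYL2 i
  have hmean : ∫ ω, S ω ∂P = n * ∫ ω, Y 0 ω ∂P := by
    simp only [hS, Finset.sum_apply]
    rw [integral_finsetSum _ fun i _ => (hYL2 i).integrable one_le_two]
    simp [(hident _).integral_eq]
  have hvar : Var[S; P] = n * Var[Y 0; P] := by
    rw [hS, IndepFun.variance_sum (fun i _ => hYL2 i) fun i _ j _ hij => hindep hij]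
    simp [(hident _).variance_eq]
  have hfun : (fun ω => (n : ℝ) * ((∑ i ∈ Finset.range n, Y i ω) / n - ∫ ω, Y 0 ω ∂P) ^ 2) =
      (n : ℝ)⁻¹ • fun ω => (S ω - ∫ ω, S ω ∂P) ^ 2 := by
    ext ω
    rw [Pi.smul_apply, smul_eq_mul, hmean, hS, Finset.sum_apply]
    field_simp
  rw [hfun, eLpNorm_const_smul, eLpNorm_one_eq_lintegral_enorm]
  simp only [enorm_pow]
  rw [← evariance, ← hSL2.ofReal_variance_eq, hvar, ← ofReal_norm,
    Real.norm_of_nonneg (by positivity), ← ENNReal.ofReal_mul (by positivity),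
    inv_mul_cancel_left₀ (Nat.cast_ne_zero.2 hn)]

end MeasureConvergence

section Moments

variable {d : ℕ} {Ω : Type*} [MeasurableSpace Ω] {P : Measure Ω}
  {X : ℕ → Ω → EuclideanSpace ℝ (Fin d)} {Y : Ω → EuclideanSpace ℝ (Fin d)}
  {ν : Measure (EuclideanSpace ℝ (Fin d))} {θ₀ : Sym2 (Fin d) → ℝ}

theorem measurable_coord_mul (j k : Fin d) :
    Measurable fun x : EuclideanSpace ℝ (Fin d) => x j * x k := by
  fun_prop

theorem memLp_of_hasLaw {p : ENNReal} (hY : HasLaw Y ν P) (hν : MemLp id p ν) : MemLp Y p P := by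
  rw [← hY.map_eq] at hν
  exact hν.comp_of_map hY.aemeasurable

theorem hasSecondMoment_of_hasLaw {V : Matrix (Fin d) (Fin d) ℝ} (hY : HasLaw Y ν P)
    (hν : HasSecondMoment ν id V) : HasSecondMoment P Y V := by
  refine ⟨memLp_of_hasLaw hY hν.1, fun j k => ?_⟩
  rw [← hν.2 j k, ← hY.map_eq]
  exact (integral_map hY.aemeasurable (measurable_coord_mul j k).aestronglyMeasurable).symm

theorem memLp_coord {p : ENNReal} (hY : MemLp Y p P) (j : Fin d) : MemLp (fun ω => Y ω j) p P :=
  (EuclideanSpace.proj (𝕜 := ℝ) j).comp_memLp' hY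

theorem memLp_coord_mul {p q : ENNReal} [ENNReal.HolderTriple p p q] (hY : MemLp Y p P)
    (j k : Fin d) : MemLp (fun ω => Y ω j * Y ω k) q P :=
  (memLp_coord hY k).mul' (memLp_coord hY j)

theorem holderTriple_four_four_two : ENNReal.HolderTriple 4 4 2 where
  inv_add_inv_eq_inv := by
    rw [← two_mul, show (4 : ENNReal) = 2 * 2 by norm_num,
      ENNReal.mul_inv (by simp) (by simp), ← mul_assoc,
      ENNReal.mul_inv_cancel (by simp) (by simp), one_mul]

theorem IsIID.aemeasurable (h : IsIID P X ν) : AEMeasurable (fun ω i => X i ω) P :=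
  aemeasurable_pi_lambda _ fun i => (h.law i).aemeasurable

theorem IsIID.pairwise_indepFun_coord_mul (h : IsIID P X ν) (j k : Fin d) :
    Pairwise fun a b => IndepFun (fun ω => X a ω j * X a ω k) (fun ω => X b ω j * X b ω k) P :=
  fun _ _ hab => (h.indep.indepFun hab).comp (measurable_coord_mul j k) (measurable_coord_mul j k)

theorem IsIID.identDistrib_coord_mul (h : IsIID P X ν) (j k : Fin d) (i : ℕ) :
    IdentDistrib (fun ω => X i ω j * X i ω k) (fun ω => X 0 ω j * X 0 ω k) P P :=
  ((h.law i).identDistrib (h.law 0)).comp (measurable_coord_mul j k)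

theorem IsIID.tendsto_empirical (h : IsIID P X ν)
    (hm : HasSecondMoment P (X 0) (symMatrix θ₀)) :
    ∀ᵐ ω ∂P, Tendsto (fun n => empirical n fun i => X i ω) atTop (𝓝 θ₀) := by
  suffices hcoord : ∀ z : Sym2 (Fin d), ∀ᵐ ω ∂P,
      Tendsto (fun n => empirical n (fun i => X i ω) z) atTop (𝓝 (θ₀ z)) by
    filter_upwards [ae_all_iff.2 hcoord] with ω hω
    exact tendsto_pi_nhds.2 hω
  intro z
  induction z with
  | h j k =>
    have hlaw := strong_law_ae_real (fun i ω => X i ω j * X i ω k) (memLp_one_iff_integrable.1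
      (memLp_coord_mul hm.1 j k)) (h.pairwise_indepFun_coord_mul j k) (h.identDistrib_coord_mul j k)
    rw [hm.2 j k] at hlaw
    exact hlaw

theorem norm_sq_le_sum_sq {ι : Type*} [Fintype ι] (u : ι → ℝ) : ‖u‖ ^ 2 ≤ ∑ i, u i ^ 2 := by
  refine (Real.le_sqrt (norm_nonneg u) (Finset.sum_nonneg fun i _ => sq_nonneg (u i))).1
    ((pi_norm_le_iff_of_nonneg (Real.sqrt_nonneg _)).2 fun i => Real.abs_le_sqrt ?_)
  exact Finset.single_le_sum (f := fun i => u i ^ 2) (fun i _ => sq_nonneg _) (Finset.mem_univ i)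

theorem IsIID.eLpNorm_natCast_mul_norm_empirical_sub_sq_le [IsProbabilityMeasure P]
    (h : IsIID P X ν) (h4 : MemLp (X 0) 4 P) (hm : HasSecondMoment P (X 0) (symMatrix θ₀)) :
    ∃ C : ENNReal, C ≠ ⊤ ∧ ∀ n : ℕ, n ≠ 0 →
      eLpNorm (fun ω => (n : ℝ) * ‖empirical n (fun i => X i ω) - θ₀‖ ^ 2) 1 P ≤ C := by
  have hcoord (z : Sym2 (Fin d)) : ∃ C : ENNReal, C ≠ ⊤ ∧ ∀ n : ℕ, n ≠ 0 →
      eLpNorm (fun ω => (n : ℝ) * (empirical n (fun i => X i ω) z - θ₀ z) ^ 2) 1 P = C := by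
    have := holderTriple_four_four_two
    induction z with
    | h j k =>
      refine ⟨ENNReal.ofReal Var[fun ω => X 0 ω j * X 0 ω k; P], ENNReal.ofReal_ne_top,
        fun n hn => ?_⟩
      have hnorm := eLpNorm_natCast_mul_sq_average_sub (h.pairwise_indepFun_coord_mul j k)
        (h.identDistrib_coord_mul j k) (memLp_coord_mul h4 j k) hn
      rw [hm.2 j k] at hnorm
      exact hnorm
  choose C hC hnorm using hcoord
  refine ⟨∑ z, C z, ENNReal.sum_ne_top.2 fun z _ => hC z, fun n hn => ?_⟩
  have hmeas (z : Sym2 (Fin d)) : AEStronglyMeasurable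
      (fun ω => (n : ℝ) * (empirical n (fun i => X i ω) z - θ₀ z) ^ 2) P :=
    (((((measurable_empirical n).comp_aemeasurable h.aemeasurable).eval z).sub_const
      _).pow_const _).const_mul _ |>.aestronglyMeasurable
  calc eLpNorm (fun ω => (n : ℝ) * ‖empirical n (fun i => X i ω) - θ₀‖ ^ 2) 1 P
      ≤ eLpNorm (∑ z, fun ω => (n : ℝ) * (empirical n (fun i => X i ω) z - θ₀ z) ^ 2) 1 P := by
        refine eLpNorm_mono_real fun ω => ?_
        rw [Real.norm_of_nonneg (by positivity), Finset.sum_apply, ← Finset.mul_sum]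
        exact mul_le_mul_of_nonneg_left (norm_sq_le_sum_sq _) n.cast_nonneg
    _ ≤ ∑ z, eLpNorm (fun ω => (n : ℝ) * (empirical n (fun i => X i ω) z - θ₀ z) ^ 2) 1 P :=
        eLpNorm_sum_le (fun z _ => hmeas z) le_rfl
    _ = ∑ z, C z := Finset.sum_congr rfl fun z _ => hnorm z n hn

theorem IsIID.tendstoInMeasure_norm_empirical_sub_sq [IsProbabilityMeasure P] (h : IsIID P X ν)
    (h4 : MemLp (X 0) 4 P) (hm : HasSecondMoment P (X 0) (symMatrix θ₀)) :
    TendstoInMeasure P (fun (n : ℕ) ω => (Real.log n)⁻¹ *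
      ((n : ℝ) * ‖empirical n (fun i => X i ω) - θ₀‖ ^ 2)) atTop fun _ => 0 := by
  obtain ⟨C, hC, hbound⟩ := h.eLpNorm_natCast_mul_norm_empirical_sub_sq_le h4 hm
  refine tendstoInMeasure_mul_of_eLpNorm_one_le tendsto_log_natCast_atTop.inv_tendsto_atTop
    (fun n => ?_) hC ((eventually_ne_atTop 0).mono hbound)
  exact (((((measurable_empirical n).comp_aemeasurable h.aemeasurable).sub_const
    _).norm.pow_const _).const_mul _).aestronglyMeasurable

end Moments

section Limits

variable {d : ℕ} {Ω : Type*} [MeasurableSpace Ω] {P : Measure Ω}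
  {X : ℕ → Ω → EuclideanSpace ℝ (Fin d)} {ν : Measure (EuclideanSpace ℝ (Fin d))}
  {θ₀ : Sym2 (Fin d) → ℝ} {p p' : ℝ} {f f' : (Sym2 (Fin d) → ℝ) → ℝ}
  {E E' : ℕ → (ℕ → EuclideanSpace ℝ (Fin d)) → ℝ}

/-- `E` is the evidence of a model with `p` parameters and criterion `f` that is regular at the
second moments `θ₀`: it is positive and measurable in the sample, and the logarithmic evidence has
a Laplace expansion along every sample whose empirical second moments converge to `θ₀`. -/
structure IsRegularModel (θ₀ : Sym2 (Fin d) → ℝ) (p : ℝ) (f : (Sym2 (Fin d) → ℝ) → ℝ)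
    (E : ℕ → (ℕ → EuclideanSpace ℝ (Fin d)) → ℝ) : Prop where
  pos : ∀ n x, 0 < E n x
  measurable : ∀ n, Measurable (E n)
  expansion : ∀ x, Tendsto (fun n => empirical n x) atTop (𝓝 θ₀) →
    HasLaplaceExpansion d p (fun n => E n x) fun n => f (empirical n x)
  continuousAt : ContinuousAt f θ₀

theorem isRegularModel_evidenceA {α : ℝ} {B : Matrix (Fin d) (Fin d) ℝ}
    (hα : ((d : ℝ) - 1) / 2 < α) (hB : B.PosDef) (hθ : (symMatrix θ₀).PosDef) :
    IsRegularModel θ₀ (d * (d + 1) / 2) critA (evidenceA α B) where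
  pos := evidenceA_pos hα hB
  measurable := measurable_evidenceA hα hB
  expansion _ hx := hasLaplaceExpansion_evidenceA hα hB hθ hx
  continuousAt := (contDiffAt_critA (m := 0) hθ).continuousAt

theorem isRegularModel_evidenceD {α : ℝ} {β : Fin d → ℝ} (hα : 0 < α) (hβ : ∀ j, 0 < β j)
    (hθ : (symMatrix θ₀).PosDef) : IsRegularModel θ₀ d critD (evidenceD α β) where
  pos := evidenceD_pos hα hβ
  measurable := measurable_evidenceD hα hβ
  expansion _ hx := hasLaplaceExpansion_evidenceD hα hβ hθ hx
  continuousAt := (contDiffAt_critD (m := 0) (diag_pos_of_posDef_symMatrix hθ)).continuousAt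

theorem isRegularModel_evidenceC [NeZero d] {α β : ℝ} (hα : 0 < α) (hβ : 0 < β)
    (hθ : (symMatrix θ₀).PosDef) : IsRegularModel θ₀ 1 critC (evidenceC α β) where
  pos := evidenceC_pos hα hβ
  measurable := measurable_evidenceC hα hβ
  expansion _ hx := hasLaplaceExpansion_evidenceC hα hβ hθ hx
  continuousAt := (contDiffAt_critC (m := 0) (mean_pos_of_posDef_symMatrix hθ)).continuousAt

theorem IsRegularModel.measurable_log_div (h : IsRegularModel θ₀ p f E)
    (h' : IsRegularModel θ₀ p' f' E') (n : ℕ) :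
    Measurable fun x => Real.log (E n x / E' n x) :=
  ((h.measurable n).div (h'.measurable n)).log

theorem IsRegularModel.tendstoInMeasure_linear [IsProbabilityMeasure P]
    (h : IsRegularModel θ₀ p f E) (h' : IsRegularModel θ₀ p' f' E') (hX : IsIID P X ν)
    (hm : HasSecondMoment P (X 0) (symMatrix θ₀)) :
    TendstoInMeasure P (fun (n : ℕ) ω => (n : ℝ)⁻¹ *
      Real.log (E n (fun i => X i ω) / E' n (fun i => X i ω))) atTop
      fun _ => 1 / 2 * (f' θ₀ - f θ₀) := by
  refine tendstoInMeasure_of_tendsto_ae (fun n => (((h.measurable_log_div h' n).comp_aemeasurable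
    hX.aemeasurable).const_mul _).aestronglyMeasurable) ?_
  filter_upwards [hX.tendsto_empirical hm] with ω hω
  exact (h.expansion _ hω).tendsto_linear (h'.expansion _ hω) (fun n => h.pos n _)
    (fun n => h'.pos n _) (h.continuousAt.tendsto.comp hω) (h'.continuousAt.tendsto.comp hω)

theorem IsRegularModel.tendstoInMeasure_log [IsProbabilityMeasure P]
    (h : IsRegularModel θ₀ p f E) (h' : IsRegularModel θ₀ p' f' E')
    (hquad : (fun θ => f' θ - f θ) =O[𝓝 θ₀] fun θ => ‖θ - θ₀‖ ^ 2) (hX : IsIID P X ν)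
    (hm : HasSecondMoment P (X 0) (symMatrix θ₀)) (h4 : MemLp (X 0) 4 P) :
    TendstoInMeasure P (fun (n : ℕ) ω => (Real.log n)⁻¹ *
      Real.log (E n (fun i => X i ω) / E' n (fun i => X i ω))) atTop
      fun _ => -((p - p') / 2) := by
  -- The squared error tends to zero only in measure, so we argue along almost surely convergent
  -- subsequences.
  refine (exists_seq_tendstoInMeasure_atTop_iff fun n => (((h.measurable_log_div h'
    n).comp_aemeasurable hX.aemeasurable).const_mul _).aestronglyMeasurable).2 fun ns hns => ?_
  obtain ⟨ns', hns', hae⟩ := ((hX.tendstoInMeasure_norm_empirical_sub_sq h4 hm).comp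
    hns.tendsto_atTop).exists_seq_tendsto_ae
  refine ⟨ns', hns', ?_⟩
  filter_upwards [hX.tendsto_empirical hm, hae] with ω hω hsq
  have hsub : Tendsto (fun i => ns (ns' i)) atTop atTop :=
    hns.tendsto_atTop.comp hns'.tendsto_atTop
  refine (h.expansion _ hω).tendsto_log (h'.expansion _ hω) (fun n => h.pos n _)
    (fun n => h'.pos n _) hsub ?_
  exact ((isBigO_refl (fun i => (Real.log (ns (ns' i)))⁻¹) atTop).mul
    ((isBigO_refl (fun i => (ns (ns' i) : ℝ)) atTop).mul
      (hquad.comp_tendsto (hω.comp hsub)))).trans_tendsto hsq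

theorem halfLogHadamard_symMatrix (hθ : (symMatrix θ₀).PosDef) :
    halfLogHadamard (symMatrix θ₀) = 1 / 2 * (critD θ₀ - critA θ₀) :=
  halfLogHadamard_eq hθ

theorem logMeanRatio_symMatrix [NeZero d] (hθ : (symMatrix θ₀).PosDef) :
    logMeanRatio (symMatrix θ₀) = 1 / 2 * (critC θ₀ - critA θ₀) :=
  logMeanRatio_eq hθ

variable {V : Matrix (Fin d) (Fin d) ℝ} {αA : ℝ} {B : Matrix (Fin d) (Fin d) ℝ} {αD : ℝ}
  {β : Fin d → ℝ} {αC βC : ℝ}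

theorem IsIID.tendstoInMeasure_linear_A_D [IsProbabilityMeasure P] (h : IsIID P X ν)
    (hV : V.PosDef) (hm : HasSecondMoment P (X 0) V) (hαA : ((d : ℝ) - 1) / 2 < αA)
    (hB : B.PosDef) (hαD : 0 < αD) (hβ : ∀ j, 0 < β j) :
    TendstoInMeasure P (fun (n : ℕ) ω => (n : ℝ)⁻¹ *
      Real.log (evidenceA αA B n (fun i => X i ω) / evidenceD αD β n (fun i => X i ω))) atTop
      fun _ => halfLogHadamard V := by
  obtain ⟨θ₀, rfl⟩ := exists_symMatrix_eq hV.isHermitian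
  rw [halfLogHadamard_symMatrix hV]
  exact (isRegularModel_evidenceA hαA hB hV).tendstoInMeasure_linear
    (isRegularModel_evidenceD hαD hβ hV) h hm

theorem IsIID.tendstoInMeasure_linear_A_C [NeZero d] [IsProbabilityMeasure P]
    (h : IsIID P X ν) (hV : V.PosDef) (hm : HasSecondMoment P (X 0) V)
    (hαA : ((d : ℝ) - 1) / 2 < αA) (hB : B.PosDef) (hαC : 0 < αC) (hβC : 0 < βC) :
    TendstoInMeasure P (fun (n : ℕ) ω => (n : ℝ)⁻¹ *
      Real.log (evidenceA αA B n (fun i => X i ω) / evidenceC αC βC n (fun i => X i ω))) atTop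
      fun _ => logMeanRatio V := by
  obtain ⟨θ₀, rfl⟩ := exists_symMatrix_eq hV.isHermitian
  rw [logMeanRatio_symMatrix hV]
  exact (isRegularModel_evidenceA hαA hB hV).tendstoInMeasure_linear
    (isRegularModel_evidenceC hαC hβC hV) h hm

theorem IsIID.tendstoInMeasure_linear_D_C [NeZero d] [IsProbabilityMeasure P]
    (h : IsIID P X ν) (hV : V.PosDef) (hdiag : V.IsDiag) (hm : HasSecondMoment P (X 0) V)
    (hαD : 0 < αD) (hβ : ∀ j, 0 < β j) (hαC : 0 < αC) (hβC : 0 < βC) :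
    TendstoInMeasure P (fun (n : ℕ) ω => (n : ℝ)⁻¹ *
      Real.log (evidenceD αD β n (fun i => X i ω) / evidenceC αC βC n (fun i => X i ω))) atTop
      fun _ => logMeanRatio V := by
  obtain ⟨θ₀, rfl⟩ := exists_symMatrix_eq hV.isHermitian
  rw [logMeanRatio_symMatrix hV, ← critD_eq_critA_of_isDiag hV hdiag]
  exact (isRegularModel_evidenceD hαD hβ hV).tendstoInMeasure_linear
    (isRegularModel_evidenceC hαC hβC hV) h hm

theorem IsIID.tendstoInMeasure_log_A_D [IsProbabilityMeasure P] (h : IsIID P X ν)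
    (hV : V.PosDef) (hdiag : V.IsDiag) (hm : HasSecondMoment P (X 0) V) (h4 : MemLp (X 0) 4 P)
    (hαA : ((d : ℝ) - 1) / 2 < αA) (hB : B.PosDef) (hαD : 0 < αD) (hβ : ∀ j, 0 < β j) :
    TendstoInMeasure P (fun (n : ℕ) ω => (Real.log n)⁻¹ *
      Real.log (evidenceA αA B n (fun i => X i ω) / evidenceD αD β n (fun i => X i ω))) atTop
      fun _ => -(((d : ℝ) * ((d : ℝ) + 1) / 2 - d) / 2) := by
  obtain ⟨θ₀, rfl⟩ := exists_symMatrix_eq hV.isHermitian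
  exact (isRegularModel_evidenceA hαA hB hV).tendstoInMeasure_log
    (isRegularModel_evidenceD hαD hβ hV) (critD_sub_critA_isBigO hV hdiag) h hm h4

theorem IsIID.tendstoInMeasure_log_D_C [NeZero d] [IsProbabilityMeasure P] (h : IsIID P X ν)
    (hV : V.PosDef) {v : ℝ} (hv : ∀ j, V j j = v) (hm : HasSecondMoment P (X 0) V)
    (h4 : MemLp (X 0) 4 P) (hαD : 0 < αD) (hβ : ∀ j, 0 < β j) (hαC : 0 < αC) (hβC : 0 < βC) :
    TendstoInMeasure P (fun (n : ℕ) ω => (Real.log n)⁻¹ *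
      Real.log (evidenceD αD β n (fun i => X i ω) / evidenceC αC βC n (fun i => X i ω))) atTop
      fun _ => -(((d : ℝ) - 1) / 2) := by
  obtain ⟨θ₀, rfl⟩ := exists_symMatrix_eq hV.isHermitian
  exact (isRegularModel_evidenceD hαD hβ hV).tendstoInMeasure_log
    (isRegularModel_evidenceC hαC hβC hV) (critC_sub_critD_isBigO hV hv) h hm h4

theorem IsIID.tendstoInMeasure_log_A_C [NeZero d] [IsProbabilityMeasure P] (h : IsIID P X ν)
    (hV : V.PosDef) (hdiag : V.IsDiag) {v : ℝ} (hv : ∀ j, V j j = v)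
    (hm : HasSecondMoment P (X 0) V) (h4 : MemLp (X 0) 4 P) (hαA : ((d : ℝ) - 1) / 2 < αA)
    (hB : B.PosDef) (hαC : 0 < αC) (hβC : 0 < βC) :
    TendstoInMeasure P (fun (n : ℕ) ω => (Real.log n)⁻¹ *
      Real.log (evidenceA αA B n (fun i => X i ω) / evidenceC αC βC n (fun i => X i ω))) atTop
      fun _ => -(((d : ℝ) * ((d : ℝ) + 1) / 2 - 1) / 2) := by
  obtain ⟨θ₀, rfl⟩ := exists_symMatrix_eq hV.isHermitian
  have hquad := (critC_sub_critD_isBigO hV hv).add (critD_sub_critA_isBigO hV hdiag)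
  simp only [sub_add_sub_cancel] at hquad
  exact (isRegularModel_evidenceA hαA hB hV).tendstoInMeasure_log
    (isRegularModel_evidenceC hαC hβC hV) hquad h hm h4

end Limits

section Gaussian

variable {d : ℕ} {Ω : Type*} [MeasurableSpace Ω] {P : Measure Ω}
  {Y : Ω → EuclideanSpace ℝ (Fin d)} {H : Matrix (Fin d) (Fin d) ℝ}

theorem memLp_of_hasLaw_gaussianLaw (hY : HasLaw Y (gaussianLaw H) P) {p : ENNReal}
    (hp : p ≠ ⊤) : MemLp Y p P :=
  memLp_of_hasLaw hY (IsGaussian.memLp_id (multivariateGaussian _ _) p hp)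

theorem hasSecondMoment_multivariateGaussian {S : Matrix (Fin d) (Fin d) ℝ}
    (hS : S.PosSemidef) : HasSecondMoment (multivariateGaussian 0 S) id S := by
  have hid : MemLp (fun x => x) 2 (multivariateGaussian 0 S) := IsGaussian.memLp_two_id
  refine ⟨hid, fun j k => ?_⟩
  have hmean (j : Fin d) : ∫ x, x j ∂(multivariateGaussian 0 S) = 0 := by
    have hcomm := (EuclideanSpace.proj (𝕜 := ℝ) j).integral_comp_comm (hid.integrable one_le_two)
    rw [integral_id_multivariateGaussian, map_zero] at hcomm
    exact hcomm
  have hcov := covariance_eval_multivariateGaussian (μ := 0) hS j k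
  rwa [covariance_eq_sub (memLp_coord hid j) (memLp_coord hid k), hmean, zero_mul,
    sub_zero] at hcov

theorem hasSecondMoment_of_hasLaw_gaussianLaw (hY : HasLaw Y (gaussianLaw H) P) (hH : H.PosDef) :
    HasSecondMoment P Y ((2 : ℝ) • H)⁻¹ :=
  hasSecondMoment_of_hasLaw hY
    (hasSecondMoment_multivariateGaussian (hH.smul two_pos).inv.posSemidef)

end Gaussian

/-! ### Second moments of mixtures -/

section SecondMomentDensity

theorem integrable_mul_mul_of_integrable_mul_self_mul {α : Type*} [MeasurableSpace α]
    {μ : Measure α} {f g h : α → ℝ} (hf : Integrable (fun x => f x * f x * h x) μ)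
    (hg : Integrable (fun x => g x * g x * h x) μ)
    (hfg : AEStronglyMeasurable (fun x => f x * g x * h x) μ) :
    Integrable (fun x => f x * g x * h x) μ := by
  refine (hf.norm.add hg.norm).mono' hfg (.of_forall fun x => ?_)
  have hmul : |f x| * |g x| ≤ |f x| * |f x| + |g x| * |g x| := by
    nlinarith [sq_nonneg (|f x| - |g x|), sq_nonneg (|f x| + |g x|)]
  simp only [Pi.add_apply, Real.norm_eq_abs, abs_mul, ← add_mul]
  gcongr

variable {ι : Type*} [Fintype ι]

/-- The function `ρ` has all second moments, and they are the entries of `V`. The function `ρ`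
need not be a probability density. -/
def HasSecondMomentDensity (ρ : (ι → ℝ) → ℝ) (V : Matrix ι ι ℝ) : Prop :=
  ∀ j k, Integrable (fun y => y j * y k * ρ y) ∧ ∫ y, y j * y k * ρ y = V j k

theorem HasSecondMomentDensity.mul_const {ρ : (ι → ℝ) → ℝ} {V : Matrix ι ι ℝ}
    (h : HasSecondMomentDensity ρ V) (c : ℝ) :
    HasSecondMomentDensity (fun y => ρ y * c) (c • V) := fun j k => by
  simp only [← mul_assoc, integral_mul_const, (h j k).2, Matrix.smul_apply, smul_eq_mul,
    mul_comm c, and_true]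
  exact (h j k).1.mul_const c

section Mixture

variable {T : Type*} [MeasurableSpace T] {m : Measure T} {ρ : T → (ι → ℝ) → ℝ}
  {V : T → Matrix ι ι ℝ}

theorem integrable_coord_mul_mixture (hρ : Measurable fun p : T × (ι → ℝ) => ρ p.1 p.2)
    (hρ0 : ∀ᵐ t ∂m, ∀ y, 0 ≤ ρ t y) (hmom : ∀ᵐ t ∂m, HasSecondMomentDensity (ρ t) (V t))
    (hV : ∀ j, Integrable (fun t => V t j j) m) (j k : ι) :
    Integrable (fun p : T × (ι → ℝ) => p.2 j * p.2 k * ρ p.1 p.2) (m.prod volume) := by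
  have hmeas (j k : ι) : AEStronglyMeasurable
      (fun p : T × (ι → ℝ) => p.2 j * p.2 k * ρ p.1 p.2) (m.prod volume) := by fun_prop
  have hdiag (j : ι) :
      Integrable (fun p : T × (ι → ℝ) => p.2 j * p.2 j * ρ p.1 p.2) (m.prod volume) := by
    refine (integrable_prod_iff (hmeas j j)).2 ⟨hmom.mono fun t ht => (ht j j).1,
      (hV j).congr ?_⟩
    filter_upwards [hρ0, hmom] with t ht0 ht
    simp only [Real.norm_of_nonneg (mul_nonneg (mul_self_nonneg _) (ht0 _)), (ht j j).2]
  exact integrable_mul_mul_of_integrable_mul_self_mul (hdiag j) (hdiag k) (hmeas j k)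

theorem HasSecondMomentDensity.mixture [SFinite m]
    (hρ : Measurable fun p : T × (ι → ℝ) => ρ p.1 p.2) (hρ0 : ∀ᵐ t ∂m, ∀ y, 0 ≤ ρ t y)
    (hmom : ∀ᵐ t ∂m, HasSecondMomentDensity (ρ t) (V t))
    (hV : ∀ j, Integrable (fun t => V t j j) m) :
    HasSecondMomentDensity (fun y => ∫ t, ρ t y ∂m) (Matrix.of fun j k => ∫ t, V t j k ∂m) :=
  fun j k => by
    have hint := integrable_coord_mul_mixture hρ hρ0 hmom hV j k
    simp only [← integral_const_mul, Matrix.of_apply]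
    refine ⟨hint.integral_prod_right, ?_⟩
    rw [← integral_integral_swap hint]
    exact integral_congr_ae (hmom.mono fun t ht => (ht j k).2)

end Mixture

section Product

variable {f : ι → ℝ → ℝ} {g : ℝ → ℝ} {μ : ι → Measure ℝ} [∀ i, SigmaFinite (μ i)]

theorem prod_mul_coord_eq_prod [DecidableEq ι] (f : ι → ℝ → ℝ) (g : ℝ → ℝ) (j : ι) (y : ι → ℝ) :
    (∏ i, f i (y i)) * g (y j) = ∏ i, f i (y i) * if i = j then g (y i) else 1 := by
  rw [Finset.prod_mul_distrib, Finset.prod_ite_eq' Finset.univ j, if_pos (Finset.mem_univ j)]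

theorem integrable_prod_mul_coord {j : ι} (hf : ∀ i, Integrable (f i) (μ i))
    (hg : Integrable (fun t => f j t * g t) (μ j)) :
    Integrable (fun y => (∏ i, f i (y i)) * g (y j)) (Measure.pi μ) := by
  classical
  simp only [prod_mul_coord_eq_prod]
  refine Integrable.fintype_prod (f := fun i t => f i t * if i = j then g t else 1) fun i => ?_
  rcases eq_or_ne i j with rfl | hij
  · simpa using hg
  · simpa [hij] using hf i

theorem integral_prod_mul_coord [DecidableEq ι] (f : ι → ℝ → ℝ) (g : ℝ → ℝ) (j : ι) :
    ∫ y, (∏ i, f i (y i)) * g (y j) ∂Measure.pi μ =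
      (∫ t, f j t * g t ∂μ j) * ∏ i ∈ Finset.univ.erase j, ∫ t, f i t ∂μ i := by
  simp only [prod_mul_coord_eq_prod]
  rw [integral_fintype_prod_eq_prod (f := fun i t => f i t * if i = j then g t else 1),
    ← Finset.mul_prod_erase _ _ (Finset.mem_univ j)]
  congr 1
  · simp
  · exact Finset.prod_congr rfl fun i hi => by simp [Finset.ne_of_mem_erase hi]

theorem hasSecondMomentDensity_prod [DecidableEq ι] {v : ι → ℝ}
    (hf : ∀ i, Integrable (f i)) (hf1 : ∀ i, ∫ t, f i t = 1)
    (hf_mean : ∀ i, ∫ t, f i t * t = 0)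
    (hf_sq : ∀ i, Integrable fun t => f i t * (t * t)) (hf_var : ∀ i, ∫ t, f i t * (t * t) = v i) :
    HasSecondMomentDensity (fun y => ∏ i, f i (y i)) (Matrix.diagonal v) := fun j k => by
  have hdiag (j : ι) : Integrable fun y : ι → ℝ => y j * y j * ∏ i, f i (y i) := by
    simpa only [volume_pi, mul_comm] using integrable_prod_mul_coord hf (hf_sq j)
  have hmeas : AEStronglyMeasurable fun y : ι → ℝ => y j * y k * ∏ i, f i (y i) :=
    (by fun_prop : Measurable fun y : ι → ℝ => y j * y k).aestronglyMeasurable.mul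
      (Integrable.fintype_prod hf).aestronglyMeasurable
  refine ⟨integrable_mul_mul_of_integrable_mul_self_mul (hdiag j) (hdiag k) hmeas, ?_⟩
  rcases eq_or_ne j k with rfl | hjk
  · have h := integral_prod_mul_coord (μ := fun _ => volume) f (fun t => t * t) j
    rw [Finset.prod_eq_one fun i _ => hf1 i, mul_one, hf_var] at h
    simpa only [Matrix.diagonal_apply_eq, volume_pi, mul_comm] using h
  · have h := integral_prod_mul_coord (μ := fun _ => volume)
      (fun i t => f i t * if i = j then t else 1) (fun t => t) k
    rw [Finset.prod_eq_zero (Finset.mem_erase.2 ⟨hjk, Finset.mem_univ j⟩) (by simp [hf_mean]),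
      mul_zero] at h
    rw [Matrix.diagonal_apply_ne _ hjk, ← h, volume_pi]
    refine integral_congr_ae (.of_forall fun y => ?_)
    simp only [← prod_mul_coord_eq_prod f (fun t => t) j y]
    ring

end Product

theorem HasSecondMomentDensity.of_comp_mulVec [DecidableEq ι] {ρ : (ι → ℝ) → ℝ}
    {R V : Matrix ι ι ℝ} (hR : R.det ≠ 0)
    (h : HasSecondMomentDensity (fun y => |R.det| * ρ (R *ᵥ y)) V) :
    HasSecondMomentDensity ρ (R * V * Rᵀ) := fun j k => by
  set L := LinearMap.toContinuousLinearMap (Matrix.toLin' R)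
  have hL (y : ι → ℝ) : L y = R *ᵥ y := rfl
  have hdet : L.det = R.det := LinearMap.det_toLin' R
  have hunit : IsUnit R := (Matrix.isUnit_iff_isUnit_det R).2 hR.isUnit
  have hbij : Function.Bijective L :=
    ⟨Matrix.mulVec_injective_of_isUnit hunit, Matrix.mulVec_surjective_iff_isUnit.2 hunit⟩
  have hderiv : ∀ y ∈ Set.univ, HasFDerivWithinAt L L Set.univ y :=
    fun y _ => L.hasFDerivWithinAt
  have hexpand (y : ι → ℝ) : |L.det| • (L y j * L y k * ρ (L y)) =
      ∑ p, ∑ q, R j p * R k q * (y p * y q * (|R.det| * ρ (R *ᵥ y))) := by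
    rw [hL, hdet]
    generalize ρ (R *ᵥ y) = r
    simp only [Matrix.mulVec, dotProduct]
    rw [Finset.sum_mul_sum]
    simp only [Finset.sum_mul, smul_eq_mul, Finset.mul_sum]
    exact Finset.sum_congr rfl fun p _ => Finset.sum_congr rfl fun q _ => by ring
  have hint (p q : ι) := (h p q).1.const_mul (R j p * R k q)
  constructor
  · rw [← integrableOn_univ, ← hbij.surjective.range_eq, ← Set.image_univ,
      integrableOn_image_iff_integrableOn_abs_det_fderiv_smul volume .univ hderiv
        hbij.injective.injOn, integrableOn_univ]
    simp only [hexpand]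
    exact integrable_finsetSum _ fun p _ => integrable_finsetSum _ fun q _ => hint p q
  · rw [← setIntegral_univ, ← hbij.surjective.range_eq, ← Set.image_univ,
      integral_image_eq_integral_abs_det_fderiv_smul volume .univ hderiv hbij.injective.injOn,
      setIntegral_univ]
    simp only [hexpand]
    rw [integral_finsetSum _ fun p _ => integrable_finsetSum _ fun q _ => hint p q]
    simp only [integral_finsetSum _ fun q _ => hint _ q, integral_const_mul, (h _ _).2,
      Matrix.mul_apply, Matrix.transpose_apply, Finset.sum_mul]
    rw [Finset.sum_comm]
    exact Finset.sum_congr rfl fun q _ => Finset.sum_congr rfl fun p _ => by ring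

theorem hasSecondMoment_withDensity {d : ℕ} {ρ : EuclideanSpace ℝ (Fin d) → ℝ}
    {V : Matrix (Fin d) (Fin d) ℝ} (hρ : Measurable ρ) (hρ0 : ∀ x, 0 ≤ ρ x)
    (h : HasSecondMomentDensity (fun y => ρ (WithLp.toLp 2 y)) V) :
    HasSecondMoment (volume.withDensity fun x => ENNReal.ofReal (ρ x)) id V := by
  have hmp := PiLp.volume_preserving_toLp (Fin d)
  have hemb : MeasurableEmbedding (WithLp.toLp 2 : (Fin d → ℝ) → EuclideanSpace ℝ (Fin d)) :=
    (MeasurableEquiv.toLp 2 (Fin d → ℝ)).measurableEmbedding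
  have hint (j k : Fin d) : Integrable (fun x : EuclideanSpace ℝ (Fin d) => x j * x k)
      (volume.withDensity fun x => ENNReal.ofReal (ρ x)) := by
    rw [integrable_withDensity_iff_integrable_smul₀' hρ.ennreal_ofReal.aemeasurable (by simp)]
    simp only [ENNReal.toReal_ofReal (hρ0 _), smul_eq_mul, mul_comm (ρ _)]
    exact (hmp.integrable_comp_emb hemb).1 (h j k).1
  refine ⟨?_, fun j k => ?_⟩
  · rw [memLp_two_iff_integrable_sq_norm aestronglyMeasurable_id]
    simp only [id, EuclideanSpace.real_norm_sq_eq]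
    simp only [sq]
    exact integrable_finsetSum _ fun j _ => hint j j
  · rw [integral_withDensity_eq_integral_toReal_smul₀ hρ.ennreal_ofReal.aemeasurable (by simp),
      ← (h j k).2, ← hmp.integral_comp hemb]
    simp only [ENNReal.toReal_ofReal (hρ0 _), smul_eq_mul, mul_comm, id]

end SecondMomentDensity

/-! ### Marginal laws of one observation -/

section NormalDensity

/-- The density of the centred normal distribution on `ℝ` with half-precision `τ`, i.e. with
variance `(2τ)⁻¹`. -/
def normalDensity (τ y : ℝ) : ℝ := √(τ / Real.pi) * Real.exp (-(τ * (y * y)))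

variable {τ : ℝ}

theorem toNNReal_inv_two_mul_ne_zero (hτ : 0 < τ) : (2 * τ)⁻¹.toNNReal ≠ 0 :=
  (Real.toNNReal_pos.2 (by positivity)).ne'

theorem normalDensity_eq_gaussianPDFReal (hτ : 0 < τ) :
    normalDensity τ = gaussianPDFReal 0 (2 * τ)⁻¹.toNNReal := by
  ext y
  rw [normalDensity, gaussianPDFReal, Real.coe_toNNReal _ (by positivity), ← Real.sqrt_inv]
  congr 2
  · field_simp
  · field_simp
    ring

theorem integrable_normalDensity (hτ : 0 < τ) : Integrable (normalDensity τ) :=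
  normalDensity_eq_gaussianPDFReal hτ ▸ integrable_gaussianPDFReal _ _

theorem integral_normalDensity (hτ : 0 < τ) : ∫ y, normalDensity τ y = 1 := by
  rw [normalDensity_eq_gaussianPDFReal hτ]
  exact integral_gaussianPDFReal_eq_one 0 (toNNReal_inv_two_mul_ne_zero hτ)

theorem integral_normalDensity_mul (hτ : 0 < τ) (g : ℝ → ℝ) :
    ∫ y, normalDensity τ y * g y = ∫ y, g y ∂gaussianReal 0 (2 * τ)⁻¹.toNNReal := by
  rw [integral_gaussianReal_eq_integral_smul (toNNReal_inv_two_mul_ne_zero hτ),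
    normalDensity_eq_gaussianPDFReal hτ]
  rfl

theorem integral_normalDensity_mul_id (hτ : 0 < τ) : ∫ y, normalDensity τ y * y = 0 := by
  rw [integral_normalDensity_mul hτ, integral_id_gaussianReal]

theorem integral_normalDensity_mul_sq (hτ : 0 < τ) :
    ∫ y, normalDensity τ y * (y * y) = (2 * τ)⁻¹ := by
  have hvar := variance_id_gaussianReal (μ := 0) (v := (2 * τ)⁻¹.toNNReal)
  rw [variance_eq_integral aemeasurable_id, Real.coe_toNNReal _ (by positivity)] at hvar
  simpa only [id, integral_id_gaussianReal, sub_zero, sq, integral_normalDensity_mul hτ]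
    using hvar

theorem integrable_normalDensity_mul_sq (hτ : 0 < τ) :
    Integrable fun y => normalDensity τ y * (y * y) := by
  refine .of_integral_ne_zero ?_
  rw [integral_normalDensity_mul_sq hτ]
  positivity

end NormalDensity

section Likelihood

variable {d : ℕ}

theorem likelihood_diagonal_one {η : Fin d → ℝ} (hη : ∀ j, 0 ≤ η j) (y : Fin d → ℝ) :
    likelihood (Matrix.diagonal η) 1 (fun _ => WithLp.toLp 2 y) =
      ∏ j, normalDensity (η j) (y j) := by
  rw [likelihood_diagonal hη]
  refine Finset.prod_congr rfl fun j _ => ?_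
  rw [normalDensity, Real.sqrt_eq_rpow, Real.div_rpow (hη j) Real.pi_pos.le]
  simp [scatter]

theorem hasSecondMomentDensity_likelihood_diagonal {η : Fin d → ℝ} (hη : ∀ j, 0 < η j) :
    HasSecondMomentDensity (fun y => likelihood (Matrix.diagonal η) 1 fun _ => WithLp.toLp 2 y)
      (Matrix.diagonal fun j => (2 * η j)⁻¹) := by
  simp only [likelihood_diagonal_one fun j => (hη j).le]
  exact hasSecondMomentDensity_prod (fun j => integrable_normalDensity (hη j))
    (fun j => integral_normalDensity (hη j)) (fun j => integral_normalDensity_mul_id (hη j))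
    (fun j => integrable_normalDensity_mul_sq (hη j))
    fun j => integral_normalDensity_mul_sq (hη j)

theorem likelihood_diagonal_nonneg {η : Fin d → ℝ} (hη : ∀ j, 0 ≤ η j) (n : ℕ)
    (x : ℕ → EuclideanSpace ℝ (Fin d)) : 0 ≤ likelihood (Matrix.diagonal η) n x := by
  rw [likelihood_diagonal hη]
  exact Finset.prod_nonneg fun j _ => by have := hη j; positivity

theorem measurable_likelihood_diagonal_one : Measurable fun p : (Fin d → ℝ) × (Fin d → ℝ) =>
    likelihood (Matrix.diagonal p.1) 1 fun _ => WithLp.toLp 2 p.2 := by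
  simp only [likelihood, Matrix.det_diagonal, Matrix.trace, Matrix.diag_apply,
    Matrix.diagonal_mul, scatter, Matrix.of_apply]
  fun_prop

end Likelihood

section Gamma

variable {α β : ℝ}

theorem integral_gammaPDFReal (hα : 0 < α) (hβ : 0 < β) :
    ∫ t in Set.Ioi (0 : ℝ), gammaPDFReal α β t = 1 := by
  have h := integral_rpow_mul_exp_neg_mul_gammaPDFReal (α := α) (β := β) (m := 0) (s := 0)
    (by simpa) (by simpa)
  simp only [Real.rpow_zero, mul_zero, neg_zero, Real.exp_zero, one_mul, add_zero] at h
  rw [h, Real.rpow_neg hβ.le]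
  have : 0 < Real.Gamma α := Real.Gamma_pos_of_pos hα
  field_simp

theorem integral_gammaPDFReal_mul_inv (hα : 1 < α) (hβ : 0 < β) :
    ∫ t in Set.Ioi (0 : ℝ), gammaPDFReal α β t * (2 * t)⁻¹ = β / (2 * α - 2) := by
  have hα' : 0 < α - 1 := sub_pos.2 hα
  have hΓ : Real.Gamma α = (α - 1) * Real.Gamma (α - 1) := by
    rw [← Real.Gamma_add_one hα'.ne', sub_add_cancel]
  calc ∫ t in Set.Ioi (0 : ℝ), gammaPDFReal α β t * (2 * t)⁻¹
      = ∫ t in Set.Ioi (0 : ℝ), 2⁻¹ * (t ^ (-1 : ℝ) * Real.exp (-(t * 0)) *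
          gammaPDFReal α β t) := by
        refine setIntegral_congr_fun measurableSet_Ioi fun t _ => ?_
        simp only [Real.rpow_neg_one, mul_zero, neg_zero, Real.exp_zero, mul_inv]
        ring
    _ = 2⁻¹ * (β ^ α / Real.Gamma α * (Real.Gamma (α - 1) * β ^ (-(α - 1)))) := by
        rw [integral_const_mul, integral_rpow_mul_exp_neg_mul_gammaPDFReal hα' (by simpa),
          add_zero, ← sub_eq_add_neg]
    _ = β / (2 * α - 2) := by
        rw [hΓ, Real.rpow_neg hβ.le, Real.rpow_sub_one hβ.ne',
          show 2 * α - 2 = 2 * (α - 1) by ring]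
        field_simp

theorem integrableOn_gammaPDFReal (hα : 0 < α) (hβ : 0 < β) :
    IntegrableOn (gammaPDFReal α β) (Set.Ioi 0) :=
  .of_integral_ne_zero (integral_gammaPDFReal hα hβ ▸ one_ne_zero)

theorem integrableOn_gammaPDFReal_mul_inv (hα : 1 < α) (hβ : 0 < β) :
    IntegrableOn (fun t => gammaPDFReal α β t * (2 * t)⁻¹) (Set.Ioi 0) := by
  refine .of_integral_ne_zero ?_
  rw [integral_gammaPDFReal_mul_inv hα hβ]
  exact div_ne_zero hβ.ne' (by linarith)

end Gamma

section MarginalLaw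

variable {d : ℕ}

theorem hasSecondMomentDensity_integral_likelihood_diagonal {T : Type*} [MeasurableSpace T]
    {m : Measure T} [SFinite m] {η : T → Fin d → ℝ} {w : T → ℝ} (hη : Measurable η)
    (hw : Measurable w) (hη0 : ∀ᵐ t ∂m, ∀ j, 0 < η t j) (hw0 : ∀ t, 0 ≤ w t)
    (hint : ∀ j, Integrable (fun t => w t * (2 * η t j)⁻¹) m) :
    HasSecondMomentDensity
      (fun y => ∫ t, likelihood (Matrix.diagonal (η t)) 1 (fun _ => WithLp.toLp 2 y) * w t ∂m)
      (Matrix.diagonal fun j => ∫ t, w t * (2 * η t j)⁻¹ ∂m) := by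
  have hmix := HasSecondMomentDensity.mixture (m := m)
    (ρ := fun t y => likelihood (Matrix.diagonal (η t)) 1 (fun _ => WithLp.toLp 2 y) * w t)
    (V := fun t => w t • Matrix.diagonal fun j => (2 * η t j)⁻¹)
    ((measurable_likelihood_diagonal_one.comp (by fun_prop :
      Measurable fun p : T × (Fin d → ℝ) => (η p.1, p.2))).mul (hw.comp measurable_fst))
    (hη0.mono fun t ht y =>
      mul_nonneg (likelihood_diagonal_nonneg (fun j => (ht j).le) 1 _) (hw0 t))
    (hη0.mono fun t ht => (hasSecondMomentDensity_likelihood_diagonal ht).mul_const (w t))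
    (by simpa only [Matrix.smul_apply, Matrix.diagonal_apply_eq, smul_eq_mul] using hint)
  suffices hV : (Matrix.of fun j k => ∫ t, (w t • Matrix.diagonal fun j => (2 * η t j)⁻¹) j k ∂m) =
      Matrix.diagonal fun j => ∫ t, w t * (2 * η t j)⁻¹ ∂m from hV ▸ hmix
  ext j k
  rcases eq_or_ne j k with rfl | hjk
  · simp only [Matrix.of_apply, Matrix.smul_apply, Matrix.diagonal_apply_eq, smul_eq_mul]
  · simp [hjk]

theorem hasSecondMomentDensity_evidenceD {α : ℝ} {β : Fin d → ℝ} (hα : 1 < α)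
    (hβ : ∀ j, 0 < β j) :
    HasSecondMomentDensity (fun y => evidenceD α β 1 fun _ => WithLp.toLp 2 y)
      (Matrix.diagonal fun j => β j / (2 * α - 2)) := by
  have hα0 : 0 < α := one_pos.trans hα
  have hset : {η : Fin d → ℝ | ∀ j, 0 < η j} = Set.univ.pi fun _ => Set.Ioi 0 := by
    ext
    simp
  have hmeas : MeasurableSet {η : Fin d → ℝ | ∀ j, 0 < η j} :=
    hset ▸ MeasurableSet.univ_pi fun _ => measurableSet_Ioi
  have hrestrict : (volume : Measure (Fin d → ℝ)).restrict {η | ∀ j, 0 < η j} =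
      Measure.pi fun _ => volume.restrict (Set.Ioi 0) := by
    rw [hset, volume_pi, Measure.restrict_pi_pi]
  have hmean (j : Fin d) : ∫ η in {η : Fin d → ℝ | ∀ j, 0 < η j},
      (∏ i, gammaPDFReal α (β i) (η i)) * (2 * η j)⁻¹ = β j / (2 * α - 2) := by
    rw [hrestrict, integral_prod_mul_coord (fun i => gammaPDFReal α (β i)) fun t => (2 * t)⁻¹,
      integral_gammaPDFReal_mul_inv hα (hβ j),
      Finset.prod_eq_one fun i _ => integral_gammaPDFReal hα0 (hβ i), mul_one]
  simp only [← hmean]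
  refine hasSecondMomentDensity_integral_likelihood_diagonal measurable_id
    (Finset.measurable_fun_prod _ fun j _ =>
      (measurable_gammaPDFReal α (β j)).comp (measurable_pi_apply j))
    (ae_restrict_mem hmeas)
    (fun η => Finset.prod_nonneg fun j _ => gammaPDFReal_nonneg hα0 (hβ j) _) fun j => ?_
  rw [hrestrict]
  exact integrable_prod_mul_coord (g := fun t => (2 * t)⁻¹)
    (fun i => integrableOn_gammaPDFReal hα0 (hβ i)) (integrableOn_gammaPDFReal_mul_inv hα (hβ j))

theorem hasSecondMomentDensity_evidenceC {α β : ℝ} (hα : 1 < α) (hβ : 0 < β) :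
    HasSecondMomentDensity (fun y => evidenceC (d := d) α β 1 fun _ => WithLp.toLp 2 y)
      ((β / (2 * α - 2)) • 1) := by
  simp only [evidenceC, Matrix.smul_one_eq_diagonal, ← integral_gammaPDFReal_mul_inv hα hβ]
  exact hasSecondMomentDensity_integral_likelihood_diagonal
    (measurable_pi_lambda (fun t _ => t) fun _ => measurable_id) (measurable_gammaPDFReal α β)
    ((ae_restrict_mem measurableSet_Ioi).mono fun _ ht _ => ht)
    (gammaPDFReal_nonneg (one_pos.trans hα) hβ)
    fun _ => integrableOn_gammaPDFReal_mul_inv hα hβ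

theorem multivariateGamma_add_half (d : ℕ) (α : ℝ) :
    multivariateGamma d (α + 1 / 2) * Real.Gamma (α + 1 / 2 - d / 2) =
      Real.Gamma (α + 1 / 2) * multivariateGamma d α := by
  induction d with
  | zero => simp [multivariateGamma]
  | succ d ih =>
    have hshift : α + 1 / 2 - ((d + 1 : ℕ) : ℝ) / 2 = α - d / 2 := by
      push_cast
      ring
    rw [multivariateGamma_succ, multivariateGamma_succ, hshift]
    linear_combination (Real.pi ^ ((d : ℝ) / 2) * Real.Gamma (α - d / 2)) * ih

theorem scatter_one (y : Fin d → ℝ) :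
    scatter 1 (fun _ => WithLp.toLp 2 y) = Matrix.vecMulVec y y := by
  ext j k
  simp [scatter, Matrix.vecMulVec_apply]

theorem det_mul_transpose_add_scatter_one (R : Matrix (Fin d) (Fin d) ℝ) (y : Fin d → ℝ) :
    (R * Rᵀ + scatter 1 fun _ => WithLp.toLp 2 (R *ᵥ y)).det = R.det ^ 2 * (1 + y ⬝ᵥ y) := by
  have hfactor : R * Rᵀ + Matrix.vecMulVec (R *ᵥ y) (R *ᵥ y) =
      R * (1 + Matrix.vecMulVec y y) * Rᵀ := by
    rw [Matrix.mul_add, Matrix.add_mul, Matrix.mul_one, Matrix.mul_vecMulVec,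
      Matrix.vecMulVec_mul, Matrix.vecMul_transpose]
  rw [scatter_one, hfactor, Matrix.det_mul, Matrix.det_mul, Matrix.det_transpose,
    Matrix.vecMulVec_eq Unit, Matrix.det_one_add_replicateCol_mul_replicateRow]
  ring

theorem abs_det_mul_evidenceA_mulVec {α : ℝ} (hα : ((d : ℝ) - 1) / 2 < α)
    {R : Matrix (Fin d) (Fin d) ℝ} (hB : (R * Rᵀ).PosDef) (y : Fin d → ℝ) :
    |R.det| * evidenceA α (R * Rᵀ) 1 (fun _ => WithLp.toLp 2 (R *ᵥ y)) =
      evidenceC (α + 1 / 2 - d / 2) 1 1 fun _ => WithLp.toLp 2 y := by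
  have hdet : (R * Rᵀ).det = R.det ^ 2 := by rw [Matrix.det_mul, Matrix.det_transpose, sq]
  have hdet_pos : 0 < R.det ^ 2 := hdet ▸ hB.det_pos
  have hyy : 0 ≤ y ⬝ᵥ y := Finset.sum_nonneg fun i _ => mul_self_nonneg _
  have htrace : (scatter 1 fun _ => WithLp.toLp 2 y).trace = y ⬝ᵥ y := by
    rw [scatter_one, Matrix.trace_vecMulVec]
  have hpow : |R.det| * ((R.det ^ 2) ^ α * (R.det ^ 2) ^ (-(α + 1 / 2))) = 1 := by
    rw [← Real.sqrt_sq_eq_abs, Real.sqrt_eq_rpow, ← Real.rpow_add hdet_pos,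
      ← Real.rpow_add hdet_pos]
    ring_nf
    exact Real.rpow_zero _
  have hγ : 0 < α + 1 / 2 - d / 2 := by linarith
  have hΓ := multivariateGamma_add_half d α
  have hΓA := multivariateGamma_pos hα
  have hΓC := Real.Gamma_pos_of_pos hγ
  rw [evidenceA_eq hα hB, evidenceC_eq hγ one_pos, det_mul_transpose_add_scatter_one, hdet, htrace,
    Real.mul_rpow hdet_pos.le (by linarith), Real.one_rpow, Nat.cast_one, one_mul, sub_add_cancel]
  generalize multivariateGamma d (α + 1 / 2) = ΓA' at hΓ ⊢
  generalize Real.Gamma (α + 1 / 2 - d / 2) = ΓC at hΓ hΓC ⊢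
  generalize Real.Gamma (α + 1 / 2) = ΓC' at hΓ ⊢
  generalize multivariateGamma d α = ΓA at hΓ hΓA ⊢
  generalize (R.det ^ 2) ^ (-(α + 1 / 2)) = p at hpow ⊢
  generalize (1 + y ⬝ᵥ y) ^ (-(α + 1 / 2)) = q
  field_simp
  linear_combination ΓA' * q * ΓC * hpow + q * hΓ

theorem hasSecondMoment_marginalLawD {α : ℝ} {β : Fin d → ℝ} (hα : 1 < α) (hβ : ∀ j, 0 < β j) :
    HasSecondMoment (marginalLawD α β) id (Matrix.diagonal fun j => β j / (2 * α - 2)) :=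
  have hα0 : 0 < α := one_pos.trans hα
  hasSecondMoment_withDensity
    ((measurable_evidenceD hα0 hβ 1).comp (measurable_pi_lambda _ fun _ => measurable_id))
    (fun _ => (evidenceD_pos hα0 hβ 1 _).le) (hasSecondMomentDensity_evidenceD hα hβ)

theorem hasSecondMoment_marginalLawA {α : ℝ} {B : Matrix (Fin d) (Fin d) ℝ}
    (hα : ((d : ℝ) + 1) / 2 < α) (hB : B.PosDef) :
    HasSecondMoment (marginalLawA α B) id ((2 * α - ((d : ℝ) + 1))⁻¹ • B) := by
  have hα' : ((d : ℝ) - 1) / 2 < α := by linarith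
  refine hasSecondMoment_withDensity
    ((measurable_evidenceA hα' hB 1).comp (measurable_pi_lambda _ fun _ => measurable_id))
    (fun _ => (evidenceA_pos hα' hB 1 _).le) ?_
  obtain ⟨R, rfl⟩ := exists_eq_mul_transpose hB.posSemidef
  have hR : R.det ≠ 0 := fun h => hB.det_pos.ne' (by simp [h])
  have hC := hasSecondMomentDensity_evidenceC (d := d) (α := α + 1 / 2 - d / 2) (by linarith)
    one_pos
  simp only [← abs_det_mul_evidenceA_mulVec hα' hB] at hC
  have hscale : (2 * α - ((d : ℝ) + 1))⁻¹ = 1 / (2 * (α + 1 / 2 - d / 2) - 2) := by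
    rw [one_div]
    ring_nf
  simpa only [hscale, Matrix.mul_smul, Matrix.smul_mul, Matrix.mul_one]
    using HasSecondMomentDensity.of_comp_mulVec
      (ρ := fun y => evidenceA α (R * Rᵀ) 1 fun _ => WithLp.toLp 2 y) hR hC

end MarginalLaw

section MainTheorem

variable {d : ℕ} {Ω : Type*} [MeasurableSpace Ω] {P : Measure Ω}
  {Y : Ω → EuclideanSpace ℝ (Fin d)} {H B : Matrix (Fin d) (Fin d) ℝ} {η β : Fin d → ℝ} {κ : ℝ}

theorem inv_two_smul_diagonal (hη : ∀ j, 0 < η j) :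
    ((2 : ℝ) • Matrix.diagonal η)⁻¹ = Matrix.diagonal fun j => (2 * η j)⁻¹ := by
  refine Matrix.inv_eq_right_inv ?_
  rw [← Matrix.diagonal_smul, Matrix.diagonal_mul_diagonal, ← Matrix.diagonal_one]
  congr 1
  ext j
  exact mul_inv_cancel₀ (mul_pos two_pos (hη j)).ne'

theorem hasSecondMoment_of_hasLaw_gaussianLaw_diagonal
    (hY : HasLaw Y (gaussianLaw (Matrix.diagonal η)) P) (hη : ∀ j, 0 < η j) :
    HasSecondMoment P Y (Matrix.diagonal fun j => (2 * η j)⁻¹) := by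
  rw [← inv_two_smul_diagonal hη]
  exact hasSecondMoment_of_hasLaw_gaussianLaw hY (Matrix.PosDef.diagonal hη)

theorem halfLogHadamard_inv_two_smul_pos (hH : H.PosDef) (hdiag : ¬ H.IsDiag) :
    0 < halfLogHadamard ((2 : ℝ) • H)⁻¹ := by
  have hdet : IsUnit ((2 : ℝ) • H).det := (hH.smul two_pos).det_pos.ne'.isUnit
  refine halfLogHadamard_pos (hH.smul two_pos).inv fun hinv => hdiag fun i j hij => ?_
  have h2H : ((2 : ℝ) • H).IsDiag := by
    rw [← Matrix.nonsing_inv_nonsing_inv _ hdet, ← hinv.diagonal_diag, Matrix.inv_diagonal]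
    exact Matrix.isDiag_diagonal _
  simpa using h2H hij

theorem logMeanRatio_inv_two_smul_pos [NeZero d] (hH : H.PosDef)
    (hscalar : ¬ ∃ c : ℝ, H = c • (1 : Matrix (Fin d) (Fin d) ℝ)) :
    0 < logMeanRatio ((2 : ℝ) • H)⁻¹ := by
  have hdet : IsUnit ((2 : ℝ) • H).det := (hH.smul two_pos).det_pos.ne'.isUnit
  refine logMeanRatio_pos (hH.smul two_pos).inv fun ⟨c, hc⟩ => hscalar ⟨(c * 2)⁻¹, ?_⟩
  have hmul : (c * 2) • H = 1 := by
    rw [mul_smul, ← Matrix.nonsing_inv_mul _ hdet, hc, Matrix.smul_mul, Matrix.one_mul]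
  rw [← hmul, inv_smul_smul₀]
  intro hzero
  exact zero_ne_one ((zero_smul ℝ H).symm.trans (hzero ▸ hmul))

theorem halfLogHadamard_smul_pos (hκ : 0 < κ) (hB : B.PosDef) (hdiag : ¬ B.IsDiag) :
    0 < halfLogHadamard (κ • B) :=
  halfLogHadamard_pos (hB.smul hκ) fun h =>
    hdiag fun _ _ hij => (smul_eq_zero.1 (h hij)).resolve_left hκ.ne'

theorem logMeanRatio_smul_pos [NeZero d] (hκ : 0 < κ) (hB : B.PosDef)
    (hscalar : ¬ ∃ c : ℝ, B = c • (1 : Matrix (Fin d) (Fin d) ℝ)) : 0 < logMeanRatio (κ • B) :=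
  logMeanRatio_pos (hB.smul hκ) fun ⟨c, hc⟩ =>
    hscalar ⟨κ⁻¹ * c, by rw [mul_smul, ← hc, inv_smul_smul₀ hκ.ne']⟩

theorem logMeanRatio_diagonal_inv_two_mul_pos [NeZero d] (hη : ∀ j, 0 < η j)
    (hconst : ¬ ∃ c, ∀ j, η j = c) :
    0 < logMeanRatio (Matrix.diagonal fun j => (2 * η j)⁻¹) :=
  logMeanRatio_diagonal_pos (fun j => inv_pos.2 (mul_pos two_pos (hη j))) fun ⟨c, hc⟩ =>
    hconst ⟨c⁻¹ / 2, fun j => by rw [← hc j, inv_inv, mul_div_cancel_left₀ _ two_ne_zero]⟩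

theorem logMeanRatio_diagonal_div_pos [NeZero d] (hκ : 0 < κ) (hβ : ∀ j, 0 < β j)
    (hconst : ¬ ∃ c, ∀ j, β j = c) : 0 < logMeanRatio (Matrix.diagonal fun j => β j / κ) :=
  logMeanRatio_diagonal_pos (fun j => div_pos (hβ j) hκ) fun ⟨c, hc⟩ =>
    hconst ⟨c * κ, fun j => (div_eq_iff hκ.ne').1 (hc j)⟩

end MainTheorem

end CovSelection

end

open CovSelection in
theorem mainTheorem4_general {d : ℕ} [NeZero d]
    (αA : ℝ) (B : Matrix (Fin d) (Fin d) ℝ) (hαA : ((d : ℝ) - 1) / 2 < αA) (hB : B.PosDef)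
    (αD : ℝ) (β : Fin d → ℝ) (hαD : 0 < αD) (hβ : ∀ j, 0 < β j)
    (αC βC : ℝ) (hαC : 0 < αC) (hβC : 0 < βC)
    {Ω : Type*} [MeasurableSpace Ω] (P : Measure Ω) [IsProbabilityMeasure P]
    (X : ℕ → Ω → EuclideanSpace ℝ (Fin d)) :
    (∀ η : ℝ, 0 < η →
      IsIID P X (gaussianLaw (η • (1 : Matrix (Fin d) (Fin d) ℝ))) →
      TendstoInMeasure P
        (fun (n : ℕ) ω => (Real.log n)⁻¹ *
          Real.log (evidenceA αA B n (fun i => X i ω) /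
            evidenceC αC βC n (fun i => X i ω)))
        atTop (fun _ => -(((d : ℝ) * ((d : ℝ) + 1) / 2 - 1) / 2)) ∧
      TendstoInMeasure P
        (fun (n : ℕ) ω => (Real.log n)⁻¹ *
          Real.log (evidenceD αD β n (fun i => X i ω) /
            evidenceC αC βC n (fun i => X i ω)))
        atTop (fun _ => -(((d : ℝ) - 1) / 2))) ∧
    (∀ η : Fin d → ℝ, (∀ j, 0 < η j) →
      IsIID P X (gaussianLaw (Matrix.diagonal η)) →
      TendstoInMeasure P
        (fun (n : ℕ) ω => (Real.log n)⁻¹ *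
          Real.log (evidenceA αA B n (fun i => X i ω) /
            evidenceD αD β n (fun i => X i ω)))
        atTop (fun _ => -(((d : ℝ) * ((d : ℝ) + 1) / 2 - d) / 2)) ∧
      ∃ v : Fin d → ℝ, (∀ j, v j = (2 * η j)⁻¹) ∧
        (∀ i, HasSecondMoment P (X i) (Matrix.diagonal v)) ∧
        TendstoInMeasure P
          (fun (n : ℕ) ω => (n : ℝ)⁻¹ *
            Real.log (evidenceD αD β n (fun i => X i ω) /
              evidenceC αC βC n (fun i => X i ω)))
          atTop (fun _ => (d : ℝ) / 2 *
            Real.log (((∑ j, v j) / d) / (∏ j, v j) ^ (1 / (d : ℝ)))) ∧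
        ((¬ ∃ c, ∀ j, η j = c) →
          0 < (d : ℝ) / 2 * Real.log (((∑ j, v j) / d) / (∏ j, v j) ^ (1 / (d : ℝ))))) ∧
    (∀ H : Matrix (Fin d) (Fin d) ℝ, H.PosDef →
      IsIID P X (gaussianLaw H) →
      ∃ V : Matrix (Fin d) (Fin d) ℝ, V = ((2 : ℝ) • H)⁻¹ ∧
        (∀ i, HasSecondMoment P (X i) V) ∧
        TendstoInMeasure P
          (fun (n : ℕ) ω => (n : ℝ)⁻¹ *
            Real.log (evidenceA αA B n (fun i => X i ω) /
              evidenceD αD β n (fun i => X i ω)))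
          atTop (fun _ => halfLogHadamard V) ∧
        TendstoInMeasure P
          (fun (n : ℕ) ω => (n : ℝ)⁻¹ *
            Real.log (evidenceA αA B n (fun i => X i ω) /
              evidenceC αC βC n (fun i => X i ω)))
          atTop (fun _ => logMeanRatio V) ∧
        (¬ H.IsDiag → 0 < halfLogHadamard V) ∧
        ((¬ ∃ c : ℝ, H = c • (1 : Matrix (Fin d) (Fin d) ℝ)) →
          0 < logMeanRatio V)) ∧
    (1 < αD → IsIID P X (marginalLawD αD β) →
      ∃ v : Fin d → ℝ, (∀ j, v j = β j / (2 * αD - 2)) ∧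
        (∀ i, HasSecondMoment P (X i) (Matrix.diagonal v)) ∧
        TendstoInMeasure P
          (fun (n : ℕ) ω => (n : ℝ)⁻¹ *
            Real.log (evidenceD αD β n (fun i => X i ω) /
              evidenceC αC βC n (fun i => X i ω)))
          atTop (fun _ => (d : ℝ) / 2 *
            Real.log (((∑ j, v j) / d) / (∏ j, v j) ^ (1 / (d : ℝ)))) ∧
        ((¬ ∃ c, ∀ j, β j = c) →
          0 < (d : ℝ) / 2 * Real.log (((∑ j, v j) / d) / (∏ j, v j) ^ (1 / (d : ℝ))))) ∧
    (((d : ℝ) + 1) / 2 < αA → IsIID P X (marginalLawA αA B) →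
      ∃ V : Matrix (Fin d) (Fin d) ℝ, V = (2 * αA - ((d : ℝ) + 1))⁻¹ • B ∧
        (∀ i, HasSecondMoment P (X i) V) ∧
        TendstoInMeasure P
          (fun (n : ℕ) ω => (n : ℝ)⁻¹ *
            Real.log (evidenceA αA B n (fun i => X i ω) /
              evidenceD αD β n (fun i => X i ω)))
          atTop (fun _ => halfLogHadamard V) ∧
        TendstoInMeasure P
          (fun (n : ℕ) ω => (n : ℝ)⁻¹ *
            Real.log (evidenceA αA B n (fun i => X i ω) /
              evidenceC αC βC n (fun i => X i ω)))
          atTop (fun _ => logMeanRatio V) ∧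
        (¬ B.IsDiag → 0 < halfLogHadamard V) ∧
        ((¬ ∃ c : ℝ, B = c • (1 : Matrix (Fin d) (Fin d) ℝ)) →
          0 < logMeanRatio V)) := by
  simp only [← logMeanRatio_diagonal]
  refine ⟨fun η hη h => ?_, fun η hη h => ?_, fun H hH h => ?_, fun hαD₁ h => ?_,
    fun hαA₁ h => ?_⟩
  · rw [Matrix.smul_one_eq_diagonal] at h
    have hV := Matrix.PosDef.diagonal fun _ : Fin d => inv_pos.2 (mul_pos two_pos hη)
    have hv := Matrix.diagonal_apply_eq fun _ : Fin d => (2 * η)⁻¹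
    have hm := hasSecondMoment_of_hasLaw_gaussianLaw_diagonal (h.law 0) fun _ => hη
    have h4 := memLp_of_hasLaw_gaussianLaw (p := 4) (h.law 0) (by simp)
    exact ⟨h.tendstoInMeasure_log_A_C hV (Matrix.isDiag_diagonal _) hv hm h4 hαA hB hαC hβC,
      h.tendstoInMeasure_log_D_C hV hv hm h4 hαD hβ hαC hβC⟩
  · have hV := Matrix.PosDef.diagonal fun j => inv_pos.2 (mul_pos two_pos (hη j))
    have hm i := hasSecondMoment_of_hasLaw_gaussianLaw_diagonal (h.law i) hη
    have h4 := memLp_of_hasLaw_gaussianLaw (p := 4) (h.law 0) (by simp)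
    exact ⟨h.tendstoInMeasure_log_A_D hV (Matrix.isDiag_diagonal _) (hm 0) h4 hαA hB hαD hβ,
      _, fun _ => rfl, hm, h.tendstoInMeasure_linear_D_C hV (Matrix.isDiag_diagonal _) (hm 0)
        hαD hβ hαC hβC, logMeanRatio_diagonal_inv_two_mul_pos hη⟩
  · have hV := (hH.smul (two_pos (α := ℝ))).inv
    have hm i := hasSecondMoment_of_hasLaw_gaussianLaw (h.law i) hH
    exact ⟨_, rfl, hm, h.tendstoInMeasure_linear_A_D hV (hm 0) hαA hB hαD hβ,
      h.tendstoInMeasure_linear_A_C hV (hm 0) hαA hB hαC hβC,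
      halfLogHadamard_inv_two_smul_pos hH, logMeanRatio_inv_two_smul_pos hH⟩
  · have hκ : 0 < 2 * αD - 2 := by linarith
    have hm i := hasSecondMoment_of_hasLaw (h.law i) (hasSecondMoment_marginalLawD hαD₁ hβ)
    exact ⟨_, fun _ => rfl, hm, h.tendstoInMeasure_linear_D_C
        (Matrix.PosDef.diagonal fun j => div_pos (hβ j) hκ) (Matrix.isDiag_diagonal _) (hm 0)
        hαD hβ hαC hβC, logMeanRatio_diagonal_div_pos hκ hβ⟩
  · have hκ : 0 < (2 * αA - ((d : ℝ) + 1))⁻¹ := inv_pos.2 (by linarith)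
    have hm i := hasSecondMoment_of_hasLaw (h.law i) (hasSecondMoment_marginalLawA hαA₁ hB)
    exact ⟨_, rfl, hm, h.tendstoInMeasure_linear_A_D (hB.smul hκ) (hm 0) hαA hB hαD hβ,
      h.tendstoInMeasure_linear_A_C (hB.smul hκ) (hm 0) hαA hB hαC hβC,
      halfLogHadamard_smul_pos hκ hB, logMeanRatio_smul_pos hκ hB⟩

theorem mainTheorem4 {d : ℕ} (hd : 1 ≤ d)
    -- hyperparameters of the priors of the models A, D and C
    (αA : ℝ) (B : Matrix (Fin d) (Fin d) ℝ) (hαA : ((d : ℝ) + 1) / 2 < αA) (hB : B.PosDef)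
    (αD : ℝ) (β : Fin d → ℝ) (hαD : 1 < αD) (hβ : ∀ j, 0 < β j)
    (αC βC : ℝ) (hαC : 1 < αC) (hβC : 0 < βC)
    -- the observations
    {Ω : Type*} [MeasurableSpace Ω] (P : Measure Ω) [IsProbabilityMeasure P]
    (X : ℕ → Ω → EuclideanSpace ℝ (Fin d)) :
    -- C is true
    (∀ η : ℝ, 0 < η →
      CovSelection.IsIID P X (CovSelection.gaussianLaw (η • (1 : Matrix (Fin d) (Fin d) ℝ))) →
      TendstoInMeasure P
        (fun (n : ℕ) ω => (Real.log n)⁻¹ *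
          Real.log (CovSelection.evidenceA αA B n (fun i => X i ω) /
            CovSelection.evidenceC αC βC n (fun i => X i ω)))
        atTop (fun _ => -(((d : ℝ) * ((d : ℝ) + 1) / 2 - 1) / 2)) ∧
      TendstoInMeasure P
        (fun (n : ℕ) ω => (Real.log n)⁻¹ *
          Real.log (CovSelection.evidenceD αD β n (fun i => X i ω) /
            CovSelection.evidenceC αC βC n (fun i => X i ω)))
        atTop (fun _ => -(((d : ℝ) - 1) / 2))) ∧
    -- D is true
    (∀ η : Fin d → ℝ, (∀ j, 0 < η j) →
      CovSelection.IsIID P X (CovSelection.gaussianLaw (Matrix.diagonal η)) →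
      TendstoInMeasure P
        (fun (n : ℕ) ω => (Real.log n)⁻¹ *
          Real.log (CovSelection.evidenceA αA B n (fun i => X i ω) /
            CovSelection.evidenceD αD β n (fun i => X i ω)))
        atTop (fun _ => -(((d : ℝ) * ((d : ℝ) + 1) / 2 - d) / 2)) ∧
      ∃ v : Fin d → ℝ, (∀ j, v j = (2 * η j)⁻¹) ∧
        (∀ i, CovSelection.HasSecondMoment P (X i) (Matrix.diagonal v)) ∧
        TendstoInMeasure P
          (fun (n : ℕ) ω => (n : ℝ)⁻¹ *
            Real.log (CovSelection.evidenceD αD β n (fun i => X i ω) /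
              CovSelection.evidenceC αC βC n (fun i => X i ω)))
          atTop (fun _ => (d : ℝ) / 2 *
            Real.log (((∑ j, v j) / d) / (∏ j, v j) ^ (1 / (d : ℝ)))) ∧
        ((¬ ∃ c, ∀ j, η j = c) →
          0 < (d : ℝ) / 2 * Real.log (((∑ j, v j) / d) / (∏ j, v j) ^ (1 / (d : ℝ))))) ∧
    -- A is true
    (∀ H : Matrix (Fin d) (Fin d) ℝ, H.PosDef →
      CovSelection.IsIID P X (CovSelection.gaussianLaw H) →
      ∃ V : Matrix (Fin d) (Fin d) ℝ, V = ((2 : ℝ) • H)⁻¹ ∧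
        (∀ i, CovSelection.HasSecondMoment P (X i) V) ∧
        TendstoInMeasure P
          (fun (n : ℕ) ω => (n : ℝ)⁻¹ *
            Real.log (CovSelection.evidenceA αA B n (fun i => X i ω) /
              CovSelection.evidenceD αD β n (fun i => X i ω)))
          atTop (fun _ => CovSelection.halfLogHadamard V) ∧
        TendstoInMeasure P
          (fun (n : ℕ) ω => (n : ℝ)⁻¹ *
            Real.log (CovSelection.evidenceA αA B n (fun i => X i ω) /
              CovSelection.evidenceC αC βC n (fun i => X i ω)))
          atTop (fun _ => CovSelection.logMeanRatio V) ∧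
        (¬ H.IsDiag → 0 < CovSelection.halfLogHadamard V) ∧
        ((¬ ∃ c : ℝ, H = c • (1 : Matrix (Fin d) (Fin d) ℝ)) →
          0 < CovSelection.logMeanRatio V)) ∧
    -- the observations are independent draws from the marginal law of model D
    (CovSelection.IsIID P X (CovSelection.marginalLawD αD β) →
      ∃ v : Fin d → ℝ, (∀ j, v j = β j / (2 * αD - 2)) ∧
        (∀ i, CovSelection.HasSecondMoment P (X i) (Matrix.diagonal v)) ∧
        TendstoInMeasure P
          (fun (n : ℕ) ω => (n : ℝ)⁻¹ *
            Real.log (CovSelection.evidenceD αD β n (fun i => X i ω) /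
              CovSelection.evidenceC αC βC n (fun i => X i ω)))
          atTop (fun _ => (d : ℝ) / 2 *
            Real.log (((∑ j, v j) / d) / (∏ j, v j) ^ (1 / (d : ℝ)))) ∧
        ((¬ ∃ c, ∀ j, β j = c) →
          0 < (d : ℝ) / 2 * Real.log (((∑ j, v j) / d) / (∏ j, v j) ^ (1 / (d : ℝ))))) ∧
    -- the observations are independent draws from the marginal law of model A
    (CovSelection.IsIID P X (CovSelection.marginalLawA αA B) →
      ∃ V : Matrix (Fin d) (Fin d) ℝ, V = (2 * αA - ((d : ℝ) + 1))⁻¹ • B ∧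
        (∀ i, CovSelection.HasSecondMoment P (X i) V) ∧
        TendstoInMeasure P
          (fun (n : ℕ) ω => (n : ℝ)⁻¹ *
            Real.log (CovSelection.evidenceA αA B n (fun i => X i ω) /
              CovSelection.evidenceD αD β n (fun i => X i ω)))
          atTop (fun _ => CovSelection.halfLogHadamard V) ∧
        TendstoInMeasure P
          (fun (n : ℕ) ω => (n : ℝ)⁻¹ *
            Real.log (CovSelection.evidenceA αA B n (fun i => X i ω) /
              CovSelection.evidenceC αC βC n (fun i => X i ω)))
          atTop (fun _ => CovSelection.logMeanRatio V) ∧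
        (¬ B.IsDiag → 0 < CovSelection.halfLogHadamard V) ∧
        ((¬ ∃ c : ℝ, B = c • (1 : Matrix (Fin d) (Fin d) ℝ)) →
          0 < CovSelection.logMeanRatio V)) := by
  have : NeZero d := ⟨by omega⟩
  obtain ⟨hC, hD, hA, hDmarginal, hAmarginal⟩ := mainTheorem4_general αA B (by linarith) hB
    αD β (by linarith) hβ αC βC (by linarith) hβC P X
  exact ⟨hC, hD, hA, hDmarginal hαD, hAmarginal hαA⟩
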